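/- Let $R>0$, let $\Omega=\mathbb R^3\times(-\pi R,\pi R)\subset\mathbb R^4$ with Lebesgue measure, let $W\in L^\infty(\Omega)$ be real valued and put $$V(x)=-\frac1{|x|^2}+W(x),\qquad x\in\Omega .$$ Let $W^{1,2}(\Omega)$ be the Sobolev space of complex-valued $\psi\in L^2(\Omega)$ with weak gradient in $L^2(\Omega)$. (1) For every $\varepsilon>0$ there is a constant $C(\varepsilon)>0$, independent of $\psi$, such that for all $\psi\in W^{1,2}(\Omega)$ the function $|V||\psi|^2$ is integrable and $$\int_\Omega |V||\psi|^2\le(1+\varepsilon)\int_\Omega|\nabla\psi|^2+C(\varepsilon)\|\psi\|^2 .$$ (2) Consider in $L^2(\Omega)$ the sesquilinear forms $$h_0(\varphi,\psi)=\int_\Omega\overline{\nabla\varphi}\cdot\nabla\psi,\qquad \mathrm{Dom}(h_0)=\{\psi\in W^{1,2}(\Omega):\ \psi(x_1,x_2,x_3,-\pi R)=\psi(x_1,x_2,x_3,\pi R)\}$$ (boundary values in the sense of traces) and $$v(\varphi,\psi)=\int_\Omega V\,\overline{\varphi}\,\psi,\qquad \mathrm{Dom}(v)=\{\psi\in L^2(\Omega):\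 V|\psi|^2\in L^1(\Omega)\}.$$ For every $Z\in[0,1)$ the form sum $h=h_0+Zv$ on $\mathrm{Dom}(h_0)\cap\mathrm{Dom}(v)$ has domain $\mathrm{Dom}(h_0)$ and is densely defined, symmetric, bounded from below and closed. The operator $H=-\Delta+ZV$ associated with it, given by $$\mathrm{Dom}(H)=\{\psi\in\mathrm{Dom}(h):\ \exists\,\eta\in L^2(\Omega)\ \forall\varphi\in\mathrm{Dom}(h)\ \ h(\varphi,\psi)=\langle\varphi,\eta\rangle\},\qquad H\psi=\eta,$$ is self-adjoint and bounded from below. -/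

import Mathlib

open MeasureTheory Filter Topology
open scoped ContDiff ENNReal

noncomputable section

/-! ### Sesquilinear forms in a Hilbert space and the operators they represent -/

/-- A sesquilinear form in `𝓗` (conjugate linear in the first argument) together with its domain,
a linear subspace of `𝓗`. -/
structure SesqForm (𝓗 : Type*) [NormedAddCommGroup 𝓗] [InnerProductSpace ℂ 𝓗] where
  dom : Submodule ℂ 𝓗
  form : dom →ₗ⋆[ℂ] dom →ₗ[ℂ] ℂ

namespace SesqForm

variable {𝓗 : Type*} [NormedAddCommGroup 𝓗] [InnerProductSpace ℂ 𝓗]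

/-- The sum of two forms, on the intersection of their domains. -/
def add (a b : SesqForm 𝓗) : SesqForm 𝓗 where
  dom := a.dom ⊓ b.dom
  form := LinearMap.mk₂'ₛₗ (starRingEnd ℂ) (RingHom.id ℂ)
    (fun φ ψ =>
      a.form ⟨φ, φ.2.1⟩ ⟨ψ, ψ.2.1⟩ + b.form ⟨φ, φ.2.2⟩ ⟨ψ, ψ.2.2⟩)
    (fun φ φ' ψ => by
      have h1 := congrArg (fun l => l ⟨(ψ : 𝓗), ψ.2.1⟩)
        (a.form.map_add ⟨φ, φ.2.1⟩ ⟨φ', φ'.2.1⟩)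
      have h2 := congrArg (fun l => l ⟨(ψ : 𝓗), ψ.2.2⟩)
        (b.form.map_add ⟨φ, φ.2.2⟩ ⟨φ', φ'.2.2⟩)
      refine (congrArg₂ (· + ·) h1 h2).trans ?_
      simp only [LinearMap.add_apply]
      ring)
    (fun c φ ψ => by
      have h1 := congrArg (fun l => l ⟨(ψ : 𝓗), ψ.2.1⟩)
        (a.form.map_smulₛₗ c ⟨φ, φ.2.1⟩)
      have h2 := congrArg (fun l => l ⟨(ψ : 𝓗), ψ.2.2⟩)
        (b.form.map_smulₛₗ c ⟨φ, φ.2.2⟩)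
      refine (congrArg₂ (· + ·) h1 h2).trans ?_
      simp only [LinearMap.smul_apply, smul_add])
    (fun φ ψ ψ' => by
      have h1 := (a.form ⟨φ, φ.2.1⟩).map_add ⟨ψ, ψ.2.1⟩ ⟨ψ', ψ'.2.1⟩
      have h2 := (b.form ⟨φ, φ.2.2⟩).map_add ⟨ψ, ψ.2.2⟩ ⟨ψ', ψ'.2.2⟩
      refine (congrArg₂ (· + ·) h1 h2).trans ?_
      ring)
    (fun c φ ψ => by
      have h1 := (a.form ⟨φ, φ.2.1⟩).map_smul c ⟨ψ, ψ.2.1⟩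
      have h2 := (b.form ⟨φ, φ.2.2⟩).map_smul c ⟨ψ, ψ.2.2⟩
      refine (congrArg₂ (· + ·) h1 h2).trans ?_
      simp only [smul_add, RingHom.id_apply])

/-- A real multiple of a form, on the same domain. -/
def smul (c : ℝ) (a : SesqForm 𝓗) : SesqForm 𝓗 where
  dom := a.dom
  form := (c : ℂ) • a.form

/-- `h(φ, ψ)` is the complex conjugate of `h(ψ, φ)`. -/
def IsSymm (h : SesqForm 𝓗) : Prop :=
  ∀ φ ψ : h.dom, h.form φ ψ = starRingEnd ℂ (h.form ψ φ)

/-- `h[ψ] ≥ m ‖ψ‖²` for some real `m`. -/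
def IsBoundedBelow (h : SesqForm 𝓗) : Prop :=
  ∃ m : ℝ, ∀ ψ : h.dom, m * ‖(ψ : 𝓗)‖ ^ 2 ≤ (h.form ψ ψ).re

/-- Closedness: if `ψₙ ∈ Dom h`, `ψₙ → ψ` in `𝓗` and `h[ψₙ - ψₘ] → 0`, then `ψ ∈ Dom h` and
`h[ψₙ - ψ] → 0`. -/
def IsClosed (h : SesqForm 𝓗) : Prop :=
  ∀ (u : ℕ → h.dom) (ψ : 𝓗), Tendsto (fun n => (u n : 𝓗)) atTop (𝓝 ψ) →
    Tendsto (fun p : ℕ × ℕ => h.form (u p.1 - u p.2) (u p.1 - u p.2)) atTop (𝓝 0) →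
    ∃ hψ : ψ ∈ h.dom,
      Tendsto (fun n => h.form (u n - ⟨ψ, hψ⟩) (u n - ⟨ψ, hψ⟩)) atTop (𝓝 0)

/-- The pairs `(ψ, η)` with `ψ ∈ Dom h` and `h(φ, ψ) = ⟨φ, η⟩` for every `φ ∈ Dom h`. -/
def operatorGraph (h : SesqForm 𝓗) : Submodule ℂ (𝓗 × 𝓗) where
  carrier := {p | ∃ hp : p.1 ∈ h.dom, ∀ φ : h.dom, h.form φ ⟨p.1, hp⟩ = inner ℂ (φ : 𝓗) p.2}
  zero_mem' := ⟨h.dom.zero_mem, fun φ => by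
    have : (⟨(0 : 𝓗 × 𝓗).1, h.dom.zero_mem⟩ : h.dom) = 0 := rfl
    rw [this, map_zero, Prod.snd_zero, inner_zero_right]⟩
  add_mem' := by
    rintro p q ⟨hp, hp'⟩ ⟨hq, hq'⟩
    refine ⟨h.dom.add_mem hp hq, fun φ => ?_⟩
    have : (⟨(p + q).1, h.dom.add_mem hp hq⟩ : h.dom) = ⟨p.1, hp⟩ + ⟨q.1, hq⟩ := rfl
    rw [this, map_add, hp', hq', Prod.snd_add, inner_add_right]
  smul_mem' := by
    rintro c p ⟨hp, hp'⟩
    refine ⟨h.dom.smul_mem c hp, fun φ => ?_⟩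
    have : (⟨(c • p).1, h.dom.smul_mem c hp⟩ : h.dom) = c • ⟨p.1, hp⟩ := rfl
    rw [this, map_smul, hp', Prod.smul_snd, inner_smul_right, smul_eq_mul]

/-- The operator associated with the form `h` (first representation theorem): its domain consists
of those `ψ ∈ Dom h` for which there is `η ∈ 𝓗` with `h(φ, ψ) = ⟨φ, η⟩` for all `φ ∈ Dom h`, and
it maps `ψ` to `η`. -/
def operator (h : SesqForm 𝓗) : 𝓗 →ₗ.[ℂ] 𝓗 :=
  h.operatorGraph.toLinearPMap

/-- For a densely defined form the graph of the associated operator is as described above. -/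
theorem operator_graph (h : SesqForm 𝓗) (hd : Dense (h.dom : Set 𝓗)) :
    h.operator.graph = h.operatorGraph := by
  refine Submodule.toLinearPMap_graph_eq _ ?_
  rintro ⟨x, y⟩ ⟨hx, hxy⟩ h0
  change x = 0 at h0
  subst h0
  refine hd.eq_zero_of_inner_right ℂ fun v hv => ?_
  have h1 := hxy ⟨v, hv⟩
  have h2 : (⟨0, hx⟩ : h.dom) = 0 := rfl
  change h.form ⟨v, hv⟩ ⟨0, hx⟩ = inner ℂ v y at h1
  rw [← h1, h2, map_zero]

end SesqForm

/-- An operator `H` is bounded from below: `⟨ψ, Hψ⟩ ≥ m ‖ψ‖²` for some real `m`. -/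
def LinearPMap.IsSemibounded {𝓗 : Type*} [NormedAddCommGroup 𝓗] [InnerProductSpace ℂ 𝓗]
    (H : 𝓗 →ₗ.[ℂ] 𝓗) : Prop :=
  ∃ m : ℝ, ∀ ψ : H.domain, m * ‖(ψ : 𝓗)‖ ^ 2 ≤ (inner ℂ (ψ : 𝓗) (H ψ)).re

/-! ### The compactified configuration space and its Sobolev space -/

namespace Slab

/-- `Ω = ℝ³ × (-πR, πR)`. -/
def Ω (R : ℝ) : Set (EuclideanSpace ℝ (Fin 4)) :=
  {x | -(Real.pi * R) < x 3 ∧ x 3 < Real.pi * R}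

/-- Lebesgue measure on `Ω`. -/
abbrev μ (R : ℝ) : Measure (EuclideanSpace ℝ (Fin 4)) := volume.restrict (Ω R)

/-- `L²(Ω)`, complex valued. -/
abbrev L2 (R : ℝ) : Type := Lp ℂ 2 (μ R)

/-- The classical `i`-th partial derivative. -/
def pderiv {F : Type*} [NormedAddCommGroup F] [NormedSpace ℝ F] (i : Fin 4)
    (φ : EuclideanSpace ℝ (Fin 4) → F) (x : EuclideanSpace ℝ (Fin 4)) : F :=
  fderiv ℝ φ x (EuclideanSpace.single i 1)

/-- `g` is the weak `i`-th partial derivative of `ψ` on `Ω`. -/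
def HasWeakPartial (R : ℝ) (i : Fin 4) (ψ g : L2 R) : Prop :=
  ∀ φ : EuclideanSpace ℝ (Fin 4) → ℝ, ContDiff ℝ ∞ φ → HasCompactSupport φ → tsupport φ ⊆ Ω R →
    ∫ x in Ω R, pderiv i φ x • ψ x = - ∫ x in Ω R, φ x • g x

theorem isOpen_Ω (R : ℝ) : IsOpen (Ω R) := by
  unfold Ω
  have h : Continuous fun x : EuclideanSpace ℝ (Fin 4) => x 3 := by fun_prop
  exact (isOpen_lt continuous_const h).inter (isOpen_lt h continuous_const)

theorem integrable_test_smul {R : ℝ} {φ : EuclideanSpace ℝ (Fin 4) → ℝ} (hφ : Continuous φ)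
    (hc : HasCompactSupport φ) (ψ : L2 R) : Integrable (fun x => φ x • ψ x) (μ R) := by
  have h1 : MemLp φ 2 (μ R) := (hφ.memLp_of_hasCompactSupport hc).restrict _
  exact memLp_one_iff_integrable.1 ((Lp.memLp ψ).smul (r := 1) h1)

theorem continuous_pderiv {φ : EuclideanSpace ℝ (Fin 4) → ℝ} (hφ : ContDiff ℝ ∞ φ) (i : Fin 4) :
    Continuous (pderiv i φ) :=
  (hφ.continuous_fderiv (by simp)).clm_apply continuous_const

theorem hasCompactSupport_pderiv {φ : EuclideanSpace ℝ (Fin 4) → ℝ} (hc : HasCompactSupport φ)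
    (i : Fin 4) : HasCompactSupport (pderiv i φ) :=
  hc.fderiv_apply ℝ _

theorem HasWeakPartial.add {R : ℝ} {i : Fin 4} {ψ ψ' g g' : L2 R} (h : HasWeakPartial R i ψ g)
    (h' : HasWeakPartial R i ψ' g') : HasWeakPartial R i (ψ + ψ') (g + g') := by
  intro φ hφ hc hs
  have hd := continuous_pderiv hφ i
  have hdc := hasCompactSupport_pderiv hc i
  have e1 : ∫ x in Ω R, pderiv i φ x • (ψ + ψ') x
      = ∫ x in Ω R, (pderiv i φ x • ψ x + pderiv i φ x • ψ' x) := by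
    refine integral_congr_ae ?_
    filter_upwards [Lp.coeFn_add ψ ψ'] with x hx
    rw [hx, Pi.add_apply, smul_add]
  have e2 : ∫ x in Ω R, φ x • (g + g') x = ∫ x in Ω R, (φ x • g x + φ x • g' x) := by
    refine integral_congr_ae ?_
    filter_upwards [Lp.coeFn_add g g'] with x hx
    rw [hx, Pi.add_apply, smul_add]
  rw [e1, e2, integral_add (integrable_test_smul hd hdc ψ) (integrable_test_smul hd hdc ψ'),
    integral_add (integrable_test_smul hφ.continuous hc g)
      (integrable_test_smul hφ.continuous hc g'), h φ hφ hc hs, h' φ hφ hc hs]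
  ring

theorem HasWeakPartial.smul {R : ℝ} {i : Fin 4} {ψ g : L2 R} (c : ℂ)
    (h : HasWeakPartial R i ψ g) : HasWeakPartial R i (c • ψ) (c • g) := by
  intro φ hφ hc hs
  have e1 : ∫ x in Ω R, pderiv i φ x • (c • ψ) x = ∫ x in Ω R, c • (pderiv i φ x • ψ x) := by
    refine integral_congr_ae ?_
    filter_upwards [Lp.coeFn_smul c ψ] with x hx
    rw [hx, Pi.smul_apply, smul_comm]
  have e2 : ∫ x in Ω R, φ x • (c • g) x = ∫ x in Ω R, c • (φ x • g x) := by
    refine integral_congr_ae ?_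
    filter_upwards [Lp.coeFn_smul c g] with x hx
    rw [hx, Pi.smul_apply, smul_comm]
  rw [e1, e2, integral_smul, integral_smul, h φ hφ hc hs, smul_neg]

theorem HasWeakPartial.zero (R : ℝ) (i : Fin 4) : HasWeakPartial R i 0 0 := by
  intro φ _ _ _
  have hz : ∀ f : EuclideanSpace ℝ (Fin 4) → ℝ, ∫ x in Ω R, f x • (0 : L2 R) x = 0 := by
    intro f
    refine integral_eq_zero_of_ae ?_
    filter_upwards [Lp.coeFn_zero ℂ 2 (μ R)] with x hx
    have hx' : (0 : L2 R) x = 0 := hx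
    simp only [hx', smul_zero, Pi.zero_apply]
  rw [hz, hz, neg_zero]

/-- Weak derivatives are unique. -/
theorem HasWeakPartial.unique {R : ℝ} {i : Fin 4} {ψ g g' : L2 R} (h : HasWeakPartial R i ψ g)
    (h' : HasWeakPartial R i ψ g') : g = g' := by
  have h0 : HasWeakPartial R i (ψ + (-1 : ℂ) • ψ) (g + (-1 : ℂ) • g') := h.add (h'.smul (-1))
  rw [neg_one_smul, neg_one_smul, add_neg_cancel, ← sub_eq_add_neg] at h0
  rw [← sub_eq_zero]
  have key : ∀ᵐ x ∂(volume : Measure (EuclideanSpace ℝ (Fin 4))),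
      x ∈ Ω R → (g - g' : L2 R) x = 0 := by
    refine (isOpen_Ω R).ae_eq_zero_of_integral_contDiff_smul_eq_zero ?_ ?_
    · exact locallyIntegrableOn_of_locallyIntegrable_restrict
        ((Lp.memLp (g - g')).locallyIntegrable (by norm_num))
    · intro φ hφ hc hs
      have h1 := h0 φ hφ hc hs
      have h2 := HasWeakPartial.zero R i φ hφ hc hs
      have hz : ∫ x in Ω R, φ x • (0 : L2 R) x = 0 := by
        refine integral_eq_zero_of_ae ?_
        filter_upwards [Lp.coeFn_zero ℂ 2 (μ R)] with x hx
        have hx' : (0 : L2 R) x = 0 := hx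
        simp only [hx', smul_zero, Pi.zero_apply]
      rw [h2, hz, neg_zero] at h1
      have h3 : ∫ x in Ω R, φ x • (g - g' : L2 R) x = 0 := by
        rw [← neg_eq_zero, ← h1]
      rw [← h3]
      refine (setIntegral_eq_integral_of_forall_compl_eq_zero fun x hx => ?_).symm
      rw [image_eq_zero_of_notMem_tsupport (fun hx' => hx (hs hx')), zero_smul]
  refine (Lp.eq_zero_iff_ae_eq_zero).2 ?_
  exact (ae_restrict_iff' (isOpen_Ω R).measurableSet).2 key

/-- The Sobolev space `W^{1,2}(Ω)`. -/
def W12 (R : ℝ) : Submodule ℂ (L2 R) where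
  carrier := {ψ | ∀ i, ∃ g : L2 R, HasWeakPartial R i ψ g}
  zero_mem' := fun i => ⟨0, HasWeakPartial.zero R i⟩
  add_mem' := fun h h' i =>
    ⟨_, (h i).choose_spec.add (h' i).choose_spec⟩
  smul_mem' := fun c _ h i => ⟨_, (h i).choose_spec.smul c⟩

/-- The weak partial derivative `∂ᵢ : W^{1,2}(Ω) → L²(Ω)`. -/
def weakPartial (R : ℝ) (i : Fin 4) : W12 R →ₗ[ℂ] L2 R where
  toFun ψ := (ψ.2 i).choose
  map_add' ψ ψ' :=
    ((ψ + ψ').2 i).choose_spec.unique ((ψ.2 i).choose_spec.add (ψ'.2 i).choose_spec)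
  map_smul' c ψ := ((c • ψ).2 i).choose_spec.unique ((ψ.2 i).choose_spec.smul c)

theorem weakPartial_spec (R : ℝ) (i : Fin 4) (ψ : W12 R) :
    HasWeakPartial R i ψ (weakPartial R i ψ) :=
  (ψ.2 i).choose_spec

/-- `|∇ψ(x)|²`. -/
def gradSq {R : ℝ} (ψ : W12 R) (x : EuclideanSpace ℝ (Fin 4)) : ℝ :=
  ∑ i, ‖weakPartial R i ψ x‖ ^ 2

/-! ### Traces and the periodic boundary condition -/

/-- The point `(y₁, y₂, y₃, c)`. -/
def face (c : ℝ) (y : EuclideanSpace ℝ (Fin 3)) : EuclideanSpace ℝ (Fin 4) :=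
  !₂[y 0, y 1, y 2, c]

/-- `f ∈ L²(ℝ³)` is the trace of `ψ ∈ W^{1,2}(Ω)` on the hyperplane `x₄ = c`: there are smooth
compactly supported functions on `ℝ⁴` whose restrictions to `Ω` converge to `ψ` in `W^{1,2}(Ω)` and
whose restrictions to the hyperplane converge to `f` in `L²(ℝ³)`. -/
def HasTrace {R : ℝ} (c : ℝ) (ψ : W12 R)
    (f : Lp ℂ 2 (volume : Measure (EuclideanSpace ℝ (Fin 3)))) : Prop :=
  ∃ φ : ℕ → EuclideanSpace ℝ (Fin 4) → ℂ,
    (∀ n, ContDiff ℝ ∞ (φ n) ∧ HasCompactSupport (φ n)) ∧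
    Tendsto (fun n => eLpNorm (fun x => φ n x - (ψ : L2 R) x) 2 (μ R)) atTop (𝓝 0) ∧
    (∀ i, Tendsto (fun n => eLpNorm (fun x => pderiv i (φ n) x - weakPartial R i ψ x) 2 (μ R))
      atTop (𝓝 0)) ∧
    Tendsto (fun n => eLpNorm (fun y => φ n (face c y) - f y) 2 volume) atTop (𝓝 0)

theorem tendsto_eLpNorm_add {α : Type*} [MeasurableSpace α] {ν : Measure α}
    {a b : ℕ → α → ℂ} {u v w : α → ℂ} (ha : ∀ n, AEStronglyMeasurable (a n) ν)
    (hb : ∀ n, AEStronglyMeasurable (b n) ν) (hu : AEStronglyMeasurable u ν)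
    (hv : AEStronglyMeasurable v ν) (hw : w =ᵐ[ν] u + v)
    (h1 : Tendsto (fun n => eLpNorm (fun x => a n x - u x) 2 ν) atTop (𝓝 0))
    (h2 : Tendsto (fun n => eLpNorm (fun x => b n x - v x) 2 ν) atTop (𝓝 0)) :
    Tendsto (fun n => eLpNorm (fun x => (a n x + b n x) - w x) 2 ν) atTop (𝓝 0) := by
  have h3 := h1.add h2
  rw [add_zero] at h3
  refine tendsto_of_tendsto_of_tendsto_of_le_of_le tendsto_const_nhds h3
    (fun _ => zero_le) fun n => ?_
  have e : eLpNorm (fun x => (a n x + b n x) - w x) 2 ν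
      = eLpNorm ((fun x => a n x - u x) + fun x => b n x - v x) 2 ν := by
    refine eLpNorm_congr_ae ?_
    filter_upwards [hw] with x hx
    simp only [hx, Pi.add_apply]
    ring
  dsimp only
  rw [e]
  exact eLpNorm_add_le ((ha n).sub hu) ((hb n).sub hv) (by norm_num)

theorem tendsto_eLpNorm_smul {α : Type*} [MeasurableSpace α] {ν : Measure α}
    {a : ℕ → α → ℂ} {u w : α → ℂ} (c : ℂ) (hw : w =ᵐ[ν] c • u)
    (h1 : Tendsto (fun n => eLpNorm (fun x => a n x - u x) 2 ν) atTop (𝓝 0)) :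
    Tendsto (fun n => eLpNorm (fun x => c • a n x - w x) 2 ν) atTop (𝓝 0) := by
  have h3 := ENNReal.Tendsto.const_mul (a := ‖c‖ₑ) h1 (Or.inr enorm_ne_top)
  rw [mul_zero] at h3
  refine h3.congr fun n => ?_
  rw [← eLpNorm_const_smul]
  refine eLpNorm_congr_ae ?_
  filter_upwards [hw] with x hx
  simp only [hx, Pi.smul_apply, smul_sub]

theorem continuous_face (c : ℝ) : Continuous (face c) := by
  unfold face
  refine (PiLp.continuous_toLp 2 _).comp (continuous_pi fun i => ?_)
  fin_cases i <;> simp <;> fun_prop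

theorem continuous_pderiv' {φ : EuclideanSpace ℝ (Fin 4) → ℂ} (hφ : ContDiff ℝ ∞ φ) (i : Fin 4) :
    Continuous (pderiv i φ) :=
  (hφ.continuous_fderiv (by simp)).clm_apply continuous_const

theorem HasTrace.add {R c : ℝ} {ψ ψ' : W12 R}
    {f f' : Lp ℂ 2 (volume : Measure (EuclideanSpace ℝ (Fin 3)))}
    (h : HasTrace c ψ f) (h' : HasTrace c ψ' f') : HasTrace c (ψ + ψ') (f + f') := by
  obtain ⟨φ, hs, h1, h2, h3⟩ := h
  obtain ⟨φ', hs', h1', h2', h3'⟩ := h'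
  have hd : ∀ i n x, pderiv i (fun x => φ n x + φ' n x) x = pderiv i (φ n) x + pderiv i (φ' n) x := by
    intro i n x
    unfold pderiv
    rw [fderiv_fun_add ((hs n).1.differentiable (by simp) x)
      ((hs' n).1.differentiable (by simp) x)]
    rfl
  refine ⟨fun n x => φ n x + φ' n x, fun n => ⟨(hs n).1.add (hs' n).1, (hs n).2.add (hs' n).2⟩,
    ?_, fun i => ?_, ?_⟩
  · exact tendsto_eLpNorm_add (fun n => (hs n).1.continuous.aestronglyMeasurable)
      (fun n => (hs' n).1.continuous.aestronglyMeasurable) (Lp.aestronglyMeasurable _)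
      (Lp.aestronglyMeasurable _) (Lp.coeFn_add (ψ : L2 R) (ψ' : L2 R)) h1 h1'
  · simp only [hd, map_add]
    exact tendsto_eLpNorm_add (fun n => (continuous_pderiv' (hs n).1 i).aestronglyMeasurable)
      (fun n => (continuous_pderiv' (hs' n).1 i).aestronglyMeasurable) (Lp.aestronglyMeasurable _)
      (Lp.aestronglyMeasurable _) (Lp.coeFn_add _ _) (h2 i) (h2' i)
  · exact tendsto_eLpNorm_add
      (fun n => ((hs n).1.continuous.comp (continuous_face c)).aestronglyMeasurable)
      (fun n => ((hs' n).1.continuous.comp (continuous_face c)).aestronglyMeasurable)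
      (Lp.aestronglyMeasurable _) (Lp.aestronglyMeasurable _) (Lp.coeFn_add f f') h3 h3'

theorem HasTrace.smul {R c : ℝ} {ψ : W12 R}
    {f : Lp ℂ 2 (volume : Measure (EuclideanSpace ℝ (Fin 3)))} (z : ℂ)
    (h : HasTrace c ψ f) : HasTrace c (z • ψ) (z • f) := by
  obtain ⟨φ, hs, h1, h2, h3⟩ := h
  have hd : ∀ i n x, pderiv i (fun x => z • φ n x) x = z • pderiv i (φ n) x := by
    intro i n x
    unfold pderiv
    rw [fderiv_fun_const_smul ((hs n).1.differentiable (by simp) x)]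
    rfl
  refine ⟨fun n x => z • φ n x, fun n => ⟨(hs n).1.const_smul z, (hs n).2.smul_left (f := fun _ => z)⟩,
    ?_, fun i => ?_, ?_⟩
  · exact tendsto_eLpNorm_smul z (Lp.coeFn_smul z (ψ : L2 R)) h1
  · simp only [hd, map_smul]
    exact tendsto_eLpNorm_smul z (Lp.coeFn_smul z _) (h2 i)
  · exact tendsto_eLpNorm_smul z (Lp.coeFn_smul z f) h3

theorem HasTrace.zero (R c : ℝ) : HasTrace c (0 : W12 R) 0 := by
  have hz : ∀ {α : Type} [MeasurableSpace α] (ν : Measure α),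
      eLpNorm (fun x => (0 : ℂ) - (0 : Lp ℂ 2 ν) x) 2 ν = 0 := by
    intro α _ ν
    rw [← eLpNorm_zero (ε := ℂ) (p := 2) (μ := ν)]
    refine eLpNorm_congr_ae ?_
    filter_upwards [Lp.coeFn_zero ℂ 2 ν] with x hx
    have hx' : (0 : Lp ℂ 2 ν) x = 0 := hx
    simp only [hx', sub_zero, Pi.zero_apply]
  have hd : ∀ i x, pderiv i (fun _ => (0 : ℂ)) x = 0 := by
    intro i x
    simp [pderiv]
  refine ⟨fun _ _ => 0, fun n => ⟨contDiff_const, HasCompactSupport.zero⟩, ?_, fun i => ?_, ?_⟩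
  · exact tendsto_const_nhds.congr fun n => (hz (μ R)).symm
  · simp only [hd, map_zero]
    exact tendsto_const_nhds.congr fun n => (hz (μ R)).symm
  · exact tendsto_const_nhds.congr fun n => (hz volume).symm

/-- The `ψ ∈ W^{1,2}(Ω)` with `ψ(x₁,x₂,x₃,-πR) = ψ(x₁,x₂,x₃,πR)` in the sense of traces. -/
def periodic (R : ℝ) : Submodule ℂ (W12 R) where
  carrier := {ψ | ∃ f, HasTrace (-(Real.pi * R)) ψ f ∧ HasTrace (Real.pi * R) ψ f}
  zero_mem' := ⟨0, HasTrace.zero R _, HasTrace.zero R _⟩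
  add_mem' := fun ⟨f, h1, h2⟩ ⟨f', h1', h2'⟩ => ⟨f + f', h1.add h1', h2.add h2'⟩
  smul_mem' := fun z _ ⟨f, h1, h2⟩ => ⟨z • f, h1.smul z, h2.smul z⟩

/-- The same space as a subspace of `L²(Ω)`. -/
def W12per (R : ℝ) : Submodule ℂ (L2 R) := (periodic R).map (W12 R).subtype

theorem W12per_le (R : ℝ) : W12per R ≤ W12 R := Submodule.map_subtype_le _ _

/-! ### The forms `h₀` and `v` -/

/-- `h₀(φ, ψ) = ∑ᵢ ⟨∂ᵢφ, ∂ᵢψ⟩` on the periodic functions in `W^{1,2}(Ω)`. -/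
def kineticForm (R : ℝ) : SesqForm (L2 R) where
  dom := W12per R
  form := LinearMap.mk₂'ₛₗ (starRingEnd ℂ) (RingHom.id ℂ)
    (fun φ ψ => ∑ i, inner ℂ (weakPartial R i (Submodule.inclusion (W12per_le R) φ))
      (weakPartial R i (Submodule.inclusion (W12per_le R) ψ)))
    (fun φ φ' ψ => by simp only [map_add, inner_add_left, Finset.sum_add_distrib])
    (fun c φ ψ => by simp only [map_smul, inner_smul_left, Finset.mul_sum, smul_eq_mul])
    (fun φ ψ ψ' => by simp only [map_add, inner_add_right, Finset.sum_add_distrib])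
    (fun c φ ψ => by
      simp only [map_smul, inner_smul_right, Finset.mul_sum, smul_eq_mul, RingHom.id_apply])

/-- `V(x) = -1/|x|² + W(x)`. -/
def V {R : ℝ} (W : Lp ℝ ∞ (μ R)) (x : EuclideanSpace ℝ (Fin 4)) : ℝ :=
  -1 / ‖x‖ ^ 2 + W x

theorem aestronglyMeasurable_V {R : ℝ} (W : Lp ℝ ∞ (μ R)) :
    AEStronglyMeasurable (V W) (μ R) := by
  unfold V
  refine AEStronglyMeasurable.add ?_ (Lp.aestronglyMeasurable W)
  exact (measurable_const.div (measurable_norm.pow_const 2)).aestronglyMeasurable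

theorem integrable_potential_mul {R : ℝ} (W : Lp ℝ ∞ (μ R)) {φ ψ : L2 R}
    (hφ : Integrable (fun x => V W x * ‖φ x‖ ^ 2) (μ R))
    (hψ : Integrable (fun x => V W x * ‖ψ x‖ ^ 2) (μ R)) :
    Integrable (fun x => (V W x : ℂ) * (starRingEnd ℂ (φ x) * ψ x)) (μ R) := by
  refine (hφ.norm.add hψ.norm).mono' ?_ (Eventually.of_forall fun x => ?_)
  · refine (Complex.continuous_ofReal.comp_aestronglyMeasurable (aestronglyMeasurable_V W)).mul ?_
    exact (Complex.continuous_conj.comp_aestronglyMeasurable (Lp.aestronglyMeasurable φ)).mul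
      (Lp.aestronglyMeasurable ψ)
  · simp only [norm_mul, Complex.norm_real, RCLike.norm_conj, norm_pow, norm_norm, Pi.add_apply]
    nlinarith [norm_nonneg (V W x), mul_nonneg (norm_nonneg (V W x)) (sq_nonneg (‖φ x‖ - ‖ψ x‖)),
      mul_nonneg (norm_nonneg (V W x)) (sq_nonneg (‖φ x‖)),
      mul_nonneg (norm_nonneg (V W x)) (sq_nonneg (‖ψ x‖))]

/-- `Dom v = {ψ ∈ L²(Ω) : V|ψ|² ∈ L¹(Ω)}`. -/
def potentialDom {R : ℝ} (W : Lp ℝ ∞ (μ R)) : Submodule ℂ (L2 R) where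
  carrier := {ψ | Integrable (fun x => V W x * ‖ψ x‖ ^ 2) (μ R)}
  zero_mem' := by
    change Integrable (fun x => V W x * ‖(0 : L2 R) x‖ ^ 2) (μ R)
    refine (integrable_zero _ ℝ (μ R)).congr ?_
    filter_upwards [Lp.coeFn_zero ℂ 2 (μ R)] with x hx
    have hx' : (0 : L2 R) x = 0 := hx
    simp only [hx', norm_zero, ne_eq, OfNat.ofNat_ne_zero, not_false_eq_true, zero_pow, mul_zero]
    rfl
  add_mem' := by
    intro φ ψ hφ hψ
    change Integrable (fun x => V W x * ‖(φ + ψ) x‖ ^ 2) (μ R)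
    refine ((hφ.norm.add hψ.norm).const_mul 2).mono' ?_ ?_
    · exact (aestronglyMeasurable_V W).mul ((Lp.aestronglyMeasurable (φ + ψ)).norm.pow 2)
    · filter_upwards [Lp.coeFn_add φ ψ] with x hx
      simp only [hx, norm_mul, norm_pow, norm_norm, Pi.add_apply]
      have h1 := norm_add_le (φ x) (ψ x)
      have h2 : ‖φ x + ψ x‖ ^ 2 ≤ 2 * (‖φ x‖ ^ 2 + ‖ψ x‖ ^ 2) := by
        nlinarith [norm_nonneg (φ x + ψ x), sq_nonneg (‖φ x‖ - ‖ψ x‖), norm_nonneg (φ x),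
          norm_nonneg (ψ x)]
      nlinarith [mul_le_mul_of_nonneg_left h2 (norm_nonneg (V W x))]
  smul_mem' := by
    intro c ψ hψ
    change Integrable (fun x => V W x * ‖(c • ψ) x‖ ^ 2) (μ R)
    refine (Integrable.const_mul hψ (‖c‖ ^ 2)).congr ?_
    filter_upwards [Lp.coeFn_smul c ψ] with x hx
    simp only [hx, Pi.smul_apply, norm_smul]
    ring

/-- `v(φ, ψ) = ∫_Ω V φ̄ ψ` on `Dom v`. -/
def potentialForm {R : ℝ} (W : Lp ℝ ∞ (μ R)) : SesqForm (L2 R) where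
  dom := potentialDom W
  form := LinearMap.mk₂'ₛₗ (starRingEnd ℂ) (RingHom.id ℂ)
    (fun φ ψ => ∫ x in Ω R, (V W x : ℂ) * (starRingEnd ℂ ((φ : L2 R) x) * (ψ : L2 R) x))
    (fun φ φ' ψ => by
      rw [← integral_add (integrable_potential_mul W φ.2 ψ.2)
        (integrable_potential_mul W φ'.2 ψ.2)]
      refine integral_congr_ae ?_
      filter_upwards [Lp.coeFn_add (φ : L2 R) (φ' : L2 R)] with x hx
      rw [Submodule.coe_add, hx, Pi.add_apply, map_add]
      ring)
    (fun c φ ψ => by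
      rw [smul_eq_mul, ← integral_const_mul]
      refine integral_congr_ae ?_
      filter_upwards [Lp.coeFn_smul c (φ : L2 R)] with x hx
      rw [Submodule.coe_smul, hx, Pi.smul_apply, smul_eq_mul, map_mul]
      ring)
    (fun φ ψ ψ' => by
      rw [← integral_add (integrable_potential_mul W φ.2 ψ.2)
        (integrable_potential_mul W φ.2 ψ'.2)]
      refine integral_congr_ae ?_
      filter_upwards [Lp.coeFn_add (ψ : L2 R) (ψ' : L2 R)] with x hx
      rw [Submodule.coe_add, hx, Pi.add_apply]
      ring)
    (fun c φ ψ => by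
      rw [RingHom.id_apply, smul_eq_mul, ← integral_const_mul]
      refine integral_congr_ae ?_
      filter_upwards [Lp.coeFn_smul c (ψ : L2 R)] with x hx
      rw [Submodule.coe_smul, hx, Pi.smul_apply, smul_eq_mul]
      ring)

/-- The form sum `h₀ + Z v`. -/
def formSum {R : ℝ} (Z : ℝ) (W : Lp ℝ ∞ (μ R)) : SesqForm (L2 R) :=
  (kineticForm R).add ((potentialForm W).smul Z)

end Slab

end

/-! Everything rests on Hardy's inequality in dimension four, whose constant `((4 - 2) / 2)² = 1` is
exactly the coupling of `-1/|x|²`. The singularity is interior to the slab, so a cutoff `χ` around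
the origin removes any influence of the boundary and costs only a multiple of `‖ψ‖²`.

Hardy's inequality is proved in dual form, so `ψ` itself need not be approximated by smooth
functions. For smooth `f` the field `x ↦ rayAverage f x • x` has divergence `f`
(`rayAverage_euler`). Testing the weak gradient against `χ` times this field (`integral_cutoff_mul`)
expresses `∫ χ f ψ` through `∇ψ`, `ψ` and `|x| rayAverage f`; the last has `L²` norm at most that of
`|x| f` (`lintegral_rayAverage_le`). With `f = (|x|² + δ)^(-1/2) g̅` and `g` ranging over a dense
set, this bounds the norm of `χψ (|x|² + δ)^(-1/2)` uniformly in `δ`, and Fatou gives `hardy`. The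
bounded part `W` only adds `‖W‖ ‖ψ‖²`, which yields (1).

For (2), choosing `ε` so that `Z (1 + ε) < 1` makes the form comparable to the kinetic energy up to
multiples of `‖ψ‖²` (`formSum_bounds`). The form is therefore bounded below, and form-Cauchy
sequences have Cauchy gradients. Closedness reduces to two facts: weak derivatives pass to `L²`
limits, and so does equality of traces, by the trace inequality `exists_hasTrace_bound`. Density
comes from test functions supported in the open slab.

Finally, a closed form bounded below by `m` turns its domain into a Hilbert space with inner product
`h + (1 - m)⟨·,·⟩`. Riesz representation makes `H + (1 - m)` surjective, and a symmetric operator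
with such a surjective real shift is densely defined (here by the lower bound on the form) and
self-adjoint. -/

/-! ### The first representation theorem -/

namespace SesqForm

variable {𝓗 : Type*} [NormedAddCommGroup 𝓗] [InnerProductSpace ℂ 𝓗]

/-- The form domain, to be equipped with the form norm. -/
def FormSpace (h : SesqForm 𝓗) : Type _ := h.dom

instance (h : SesqForm 𝓗) : AddCommGroup h.FormSpace := inferInstanceAs (AddCommGroup h.dom)

instance (h : SesqForm 𝓗) : Module ℂ h.FormSpace := inferInstanceAs (Module ℂ h.dom)

/-- The identity map from the form space to the form domain. -/
def toDom (h : SesqForm 𝓗) : h.FormSpace ≃ₗ[ℂ] h.dom := LinearEquiv.refl ℂ h.dom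

/-- The inner product `h(φ, ψ) + (1 - m) ⟨φ, ψ⟩` on the domain of a form bounded below by `m`. -/
@[reducible]
noncomputable def formCore (h : SesqForm 𝓗) (hs : h.IsSymm) (m : ℝ)
    (hm : ∀ ψ : h.dom, m * ‖(ψ : 𝓗)‖ ^ 2 ≤ (h.form ψ ψ).re) :
    InnerProductSpace.Core ℂ h.FormSpace where
  inner φ ψ := h.form (h.toDom φ) (h.toDom ψ) +
    (1 - m : ℝ) * inner ℂ (h.toDom φ : 𝓗) (h.toDom ψ : 𝓗)
  conj_inner_symm φ ψ := by
    rw [map_add, ← hs, map_mul, inner_conj_symm, Complex.conj_ofReal]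
  re_inner_nonneg φ := by
    have h1 := hm (h.toDom φ)
    rw [inner_self_eq_norm_sq_to_K]
    simp only [RCLike.re_to_complex, Complex.add_re, Complex.coe_algebraMap,
      ← Complex.ofReal_pow, ← Complex.ofReal_mul, Complex.ofReal_re]
    nlinarith [sq_nonneg ‖(h.toDom φ : 𝓗)‖]
  add_left φ φ' ψ := by
    simp only [map_add, LinearMap.add_apply, Submodule.coe_add, inner_add_left]
    ring
  smul_left φ ψ c := by
    simp only [map_smul, map_smulₛₗ, LinearMap.smul_apply, Submodule.coe_smul, inner_smul_left,
      smul_eq_mul]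
    ring
  definite φ h0 := by
    have h1 := hm (h.toDom φ)
    rw [inner_self_eq_norm_sq_to_K] at h0
    have h2 := congrArg Complex.re h0
    simp only [Complex.add_re, Complex.coe_algebraMap,
      ← Complex.ofReal_pow, ← Complex.ofReal_mul, Complex.ofReal_re, Complex.zero_re] at h2
    have h3 : ‖(h.toDom φ : 𝓗)‖ ^ 2 ≤ 0 := by nlinarith
    have h4 : (h.toDom φ : 𝓗) = 0 := by
      rw [← norm_eq_zero]
      exact pow_eq_zero_iff two_ne_zero |>.1 (le_antisymm h3 (sq_nonneg _))
    exact h.toDom.map_eq_zero_iff.1 (Subtype.ext h4)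

/-- Solvability of `h(φ, ψ) + (1 - m) ⟨φ, ψ⟩ = ⟨φ, η⟩` for a closed form bounded below by `m`. -/
theorem exists_solution [CompleteSpace 𝓗] (h : SesqForm 𝓗) (hs : h.IsSymm) (m : ℝ)
    (hm : ∀ ψ : h.dom, m * ‖(ψ : 𝓗)‖ ^ 2 ≤ (h.form ψ ψ).re) (hc : h.IsClosed) (η : 𝓗) :
    ∃ ψ : h.dom, ∀ φ : h.dom,
      h.form φ ψ + (1 - m : ℝ) * inner ℂ (φ : 𝓗) (ψ : 𝓗) = inner ℂ (φ : 𝓗) η := by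
  let c := h.formCore hs m hm
  let : NormedAddCommGroup h.FormSpace := c.toNormedAddCommGroup
  let : InnerProductSpace ℂ h.FormSpace := InnerProductSpace.ofCore c.toCore
  have hin : ∀ φ ψ : h.FormSpace, inner ℂ φ ψ = h.form (h.toDom φ) (h.toDom ψ) +
      (1 - m : ℝ) * inner ℂ (h.toDom φ : 𝓗) (h.toDom ψ : 𝓗) :=
    fun _ _ => rfl
  let J : h.FormSpace →ₗ[ℂ] 𝓗 := h.dom.subtype ∘ₗ h.toDom.toLinearMap
  have hre : ∀ φ : h.dom, (h.form φ φ).im = 0 := fun φ => by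
    have := congrArg Complex.im (hs φ φ)
    simp only [Complex.conj_im] at this
    linarith
  have hnsq : ∀ φ : h.FormSpace, ‖φ‖ ^ 2 =
      (h.form (h.toDom φ) (h.toDom φ)).re + (1 - m) * ‖J φ‖ ^ 2 := fun φ => by
    have h1 : ‖φ‖ ^ 2 = (inner ℂ φ φ : ℂ).re := (inner_self_eq_norm_sq (𝕜 := ℂ) φ).symm
    rw [h1, hin, inner_self_eq_norm_sq_to_K]
    simp only [Complex.add_re, Complex.coe_algebraMap,
      ← Complex.ofReal_pow, ← Complex.ofReal_mul, Complex.ofReal_re]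
    rfl
  have hJ : ∀ φ, ‖J φ‖ ≤ 1 * ‖φ‖ := fun φ => by
    rw [one_mul]
    refine le_of_sq_le_sq ?_ (norm_nonneg _)
    rw [hnsq]
    have := hm (h.toDom φ)
    change m * ‖J φ‖ ^ 2 ≤ _ at this
    linarith
  let Jc : h.FormSpace →L[ℂ] 𝓗 := J.mkContinuous 1 hJ
  have hcomp : CompleteSpace h.FormSpace := by
    refine Metric.complete_of_cauchySeq_tendsto fun u hu => ?_
    -- The embedding `J` is a contraction, because the form norm squared is at least `‖J φ‖²`. A
    -- form-Cauchy sequence thus has a limit in `𝓗`, and closedness of `h` places it in the domain.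
    obtain ⟨x, hx⟩ := cauchySeq_tendsto_of_complete (Jc.uniformContinuous.comp_cauchySeq hu)
    have hdiff : Tendsto (fun p : ℕ × ℕ => ‖u p.1 - u p.2‖) atTop (𝓝 0) := by
      have := cauchySeq_iff_tendsto_dist_atTop_0.1 hu
      simpa only [dist_eq_norm] using this
    have hdiffJ : Tendsto (fun p : ℕ × ℕ => ‖J (u p.1 - u p.2)‖) atTop (𝓝 0) :=
      squeeze_zero (fun _ => norm_nonneg _) (fun p => (hJ _).trans (one_mul _).le) hdiff
    have hform : Tendsto (fun p : ℕ × ℕ => h.form (h.toDom (u p.1 - u p.2))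
        (h.toDom (u p.1 - u p.2))) atTop (𝓝 0) := by
      have h1 := (hdiff.pow 2).sub ((hdiffJ.pow 2).const_mul (1 - m))
      have h2 := (Complex.continuous_ofReal.tendsto _).comp h1
      simp only [ne_eq, OfNat.ofNat_ne_zero, not_false_eq_true, zero_pow, mul_zero, sub_zero,
        Complex.ofReal_zero] at h2
      refine h2.congr fun p => ?_
      apply Complex.ext
      · rw [Function.comp_apply, Complex.ofReal_re, hnsq]
        ring
      · rw [Function.comp_apply, Complex.ofReal_im, hre]
    obtain ⟨hxd, hlim⟩ := hc (fun n => h.toDom (u n)) x hx (by simpa only [map_sub] using hform)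
    refine ⟨h.toDom.symm ⟨x, hxd⟩, ?_⟩
    rw [tendsto_iff_norm_sub_tendsto_zero]
    have h1 : Tendsto (fun n => ‖Jc (u n) - x‖) atTop (𝓝 0) :=
      tendsto_iff_norm_sub_tendsto_zero.1 hx
    have h2 := ((Complex.continuous_re.tendsto _).comp hlim).add ((h1.pow 2).const_mul (1 - m))
    have h3 := (Real.continuous_sqrt.tendsto _).comp h2
    simp only [ne_eq, OfNat.ofNat_ne_zero, not_false_eq_true, zero_pow, mul_zero, add_zero,
      Complex.zero_re, Real.sqrt_zero] at h3
    refine h3.congr fun n => ?_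
    rw [← Real.sqrt_sq (norm_nonneg (u n - _)), hnsq]
    rfl
  -- Riesz representation of the bounded functional `φ ↦ ⟨η, φ⟩`; conjugation then moves `φ` to the
  -- antilinear slot.
  refine ⟨h.toDom ((InnerProductSpace.toDual ℂ h.FormSpace).symm ((innerSL ℂ η).comp Jc)), fun φ => ?_⟩
  have h1 : inner ℂ ((InnerProductSpace.toDual ℂ h.FormSpace).symm ((innerSL ℂ η).comp Jc))
      (h.toDom.symm φ) = inner ℂ η (φ : 𝓗) := by
    rw [InnerProductSpace.toDual_symm_apply]
    rfl
  have h2 := congrArg (starRingEnd ℂ) h1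
  rw [inner_conj_symm, inner_conj_symm] at h2
  exact h2

theorem operator_spec (h : SesqForm 𝓗) (hd : Dense (h.dom : Set 𝓗)) (x : h.operator.domain) :
    ∃ hx : (x : 𝓗) ∈ h.dom, ∀ φ : h.dom, h.form φ ⟨x, hx⟩ = inner ℂ (φ : 𝓗) (h.operator x) := by
  have h1 := h.operator.mem_graph x
  rw [h.operator_graph hd] at h1
  exact h1

theorem exists_operator_of_form (h : SesqForm 𝓗) (hd : Dense (h.dom : Set 𝓗)) (ψ : h.dom) (η : 𝓗)
    (hη : ∀ φ : h.dom, h.form φ ψ = inner ℂ (φ : 𝓗) η) :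
    ∃ x : h.operator.domain, (x : 𝓗) = ψ ∧ h.operator x = η := by
  have h1 : ((ψ : 𝓗), η) ∈ h.operator.graph := by
    rw [h.operator_graph hd]
    exact ⟨ψ.2, hη⟩
  exact (LinearPMap.mem_graph_iff _).1 h1

theorem operator_isSemibounded (h : SesqForm 𝓗) (hd : Dense (h.dom : Set 𝓗))
    (hb : h.IsBoundedBelow) : h.operator.IsSemibounded := by
  obtain ⟨m, hm⟩ := hb
  refine ⟨m, fun x => ?_⟩
  obtain ⟨hx, hx'⟩ := h.operator_spec hd x
  have h1 := hx' ⟨x, hx⟩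
  rw [← h1]
  exact hm ⟨x, hx⟩

/-- The operator of a densely defined, symmetric, semibounded, closed form is self-adjoint. -/
theorem operator_isSelfAdjoint [CompleteSpace 𝓗] (h : SesqForm 𝓗)
    (hd : Dense (h.dom : Set 𝓗)) (hs : h.IsSymm) (hb : h.IsBoundedBelow) (hc : h.IsClosed) :
    IsSelfAdjoint h.operator := by
  obtain ⟨m, hm⟩ := hb
  have hsol : ∀ η : 𝓗, ∃ x : h.operator.domain, h.operator x + ((1 - m : ℝ) : ℂ) • (x : 𝓗) = η := by
    intro η
    obtain ⟨ψ, hψ⟩ := h.exists_solution hs m hm hc η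
    obtain ⟨x, hx, hx'⟩ := h.exists_operator_of_form hd ψ (η - ((1 - m : ℝ) : ℂ) • (ψ : 𝓗))
      (fun φ => by rw [inner_sub_right, inner_smul_right, ← hψ φ]; ring)
    exact ⟨x, by rw [hx', hx, sub_add_cancel]⟩
  have hsymm : ∀ x y : h.operator.domain,
      inner ℂ (h.operator x) (y : 𝓗) = inner ℂ (x : 𝓗) (h.operator y) := by
    intro x y
    obtain ⟨hx, hx'⟩ := h.operator_spec hd x
    obtain ⟨hy, hy'⟩ := h.operator_spec hd y
    have h1 := hx' ⟨y, hy⟩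
    have h2 := hy' ⟨x, hx⟩
    rw [hs] at h2
    rw [← inner_conj_symm, ← h1, h2]
  have hdense : Dense (h.operator.domain : Set 𝓗) := by
    rw [Submodule.dense_iff_topologicalClosure_eq_top, Submodule.topologicalClosure_eq_top_iff,
      Submodule.eq_bot_iff]
    intro w hw
    -- If `w` is orthogonal to the domain and `Hx + (1 - m)x = w`, pairing with `x` gives `h[x] + (1
    -- - m)‖x‖² = 0`. The left side is at least `‖x‖²`, so `x = 0` and `w = 0`.
    obtain ⟨x, hx⟩ := hsol w
    obtain ⟨hxd, hx'⟩ := h.operator_spec hd x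
    have h1 : inner ℂ (x : 𝓗) w = 0 := (Submodule.mem_orthogonal _ _).1 hw x x.2
    rw [← hx, inner_add_right, ← hx' ⟨x, hxd⟩, inner_smul_right, inner_self_eq_norm_sq_to_K] at h1
    have h2 := congrArg Complex.re h1
    simp only [Complex.add_re, Complex.coe_algebraMap,
      ← Complex.ofReal_pow, ← Complex.ofReal_mul, Complex.ofReal_re, Complex.zero_re] at h2
    have h3 := hm ⟨x, hxd⟩
    have h4 : ‖(x : 𝓗)‖ ^ 2 ≤ 0 := by
      simp only at h3
      nlinarith
    have h5 : (x : 𝓗) = 0 := by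
      rw [← norm_eq_zero]
      exact pow_eq_zero_iff two_ne_zero |>.1 (le_antisymm h4 (sq_nonneg _))
    have h6 : x = 0 := Subtype.ext h5
    rw [← hx, h6, LinearPMap.map_zero]
    simp
  rw [LinearPMap.isSelfAdjoint_def]
  have hle : h.operator ≤ h.operator.adjoint :=
    LinearPMap.IsFormalAdjoint.le_adjoint hdense hsymm
  refine (LinearPMap.eq_of_le_of_domain_eq hle (le_antisymm hle.1 fun y hy => ?_)).symm
  -- Choose `x` in the domain with `(H + 1 - m)x = (H* + 1 - m)y`. Then `y - x` is orthogonal to the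
  -- range of `H + 1 - m`, which is the whole space, so `y = x`.
  obtain ⟨x, hx⟩ := hsol (h.operator.adjoint ⟨y, hy⟩ + ((1 - m : ℝ) : ℂ) • y)
  have key : y - x = 0 := by
    obtain ⟨z, hz⟩ := hsol (y - x)
    have h1 := (LinearPMap.adjoint_isFormalAdjoint hdense) ⟨y, hy⟩ z
    have h2 := hsymm x z
    have h3 : inner ℂ (y - x) (y - (x : 𝓗)) = (0 : ℂ) := by
      nth_rewrite 2 [← hz]
      rw [inner_sub_left, inner_add_right, inner_add_right, ← h2, inner_smul_right,
        inner_smul_right]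
      simp only at h1
      rw [← h1]
      have h4 := congrArg (fun a => inner ℂ a (z : 𝓗)) hx
      simp only [inner_add_left, inner_smul_left, Complex.conj_ofReal] at h4
      linear_combination -h4
    exact inner_self_eq_zero.1 h3
  rw [sub_eq_zero.1 key]
  exact x.2

end SesqForm

/-! ### Averages along rays -/

section RadialAverage

variable {E : Type} [NormedAddCommGroup E] [NormedSpace ℝ E] [FiniteDimensional ℝ E]

/-- The chain rule for `x ↦ t • x` contributes one more factor `t`. The derivative is thus again an
integral of the same type, with exponent `k + 1` and integrand `fderiv ℝ F`, which allows iteration.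
-/
theorem hasFDerivAt_integral_pow_smul_comp {G : Type} [NormedAddCommGroup G] [NormedSpace ℝ G]
    {F : E → G} (hF : ContDiff ℝ 1 F) (k : ℕ) (x₀ : E) :
    HasFDerivAt (fun x => ∫ t in (0 : ℝ)..1, t ^ k • F (t • x))
      (∫ t in (0 : ℝ)..1, t ^ (k + 1) • fderiv ℝ F (t • x₀)) x₀ := by
  have hF' : Continuous (fderiv ℝ F) := hF.continuous_fderiv (by simp)
  have hFc := hF.continuous
  -- For `t ∈ [0, 1]` the ray point `t • x` stays in this ball when `x` is within distance one of
  -- `x₀`, so a constant dominates the derivatives.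
  obtain ⟨M, hM⟩ := (isCompact_closedBall (0 : E) (‖x₀‖ + 1)).exists_bound_of_continuousOn
    hF'.continuousOn
  have hI : ∀ t ∈ Set.uIoc (0 : ℝ) 1, 0 ≤ t ∧ t ≤ 1 := fun t ht => by
    rw [Set.uIoc_of_le zero_le_one] at ht
    exact ⟨ht.1.le, ht.2⟩
  refine intervalIntegral.hasFDerivAt_integral_of_dominated_of_fderiv_le (bound := fun _ => M)
    (F' := fun x t => t ^ (k + 1) • fderiv ℝ F (t • x))
    (Metric.ball_mem_nhds x₀ one_pos) (Eventually.of_forall fun x => ?_) ?_ ?_ ?_ ?_ ?_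
  · exact Continuous.aestronglyMeasurable (by fun_prop)
  · exact Continuous.intervalIntegrable (by fun_prop) _ _
  · exact Continuous.aestronglyMeasurable (by fun_prop)
  · refine Eventually.of_forall fun t ht x hx => ?_
    obtain ⟨h0, h1⟩ := hI t ht
    have hx' : ‖x‖ ≤ ‖x₀‖ + 1 := by
      have h2 : ‖x - x₀‖ < 1 := by simpa [dist_eq_norm] using hx
      have h3 := norm_sub_norm_le x x₀
      linarith
    have h2 := hM (t • x) (by
      rw [mem_closedBall_zero_iff, norm_smul, Real.norm_of_nonneg h0]
      nlinarith [norm_nonneg x])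
    rw [norm_smul, norm_pow, Real.norm_of_nonneg h0]
    calc t ^ (k + 1) * ‖fderiv ℝ F (t • x)‖ ≤ 1 * ‖fderiv ℝ F (t • x)‖ := by
          gcongr
          exact pow_le_one₀ h0 h1
      _ ≤ M := by rwa [one_mul]
  · exact intervalIntegrable_const
  · refine Eventually.of_forall fun t ht x hx => ?_
    have h1 : HasFDerivAt (fun x : E => t • x) (t • ContinuousLinearMap.id ℝ E) x :=
      (hasFDerivAt_id x).const_smul t
    have h2 := ((hF.differentiable (by simp) (t • x)).hasFDerivAt.comp x h1).const_smul (t ^ k)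
    refine h2.congr_fderiv ?_
    ext v
    simp [pow_succ, smul_smul]

/-- Each derivative changes both the target space and the exponent, so the induction on `n` must
quantify over `G` and `k`. -/
theorem contDiff_integral_pow_smul_comp (n : ℕ) : ∀ {G : Type} [NormedAddCommGroup G]
    [NormedSpace ℝ G] {F : E → G} (_ : ContDiff ℝ ∞ F) (k : ℕ),
    ContDiff ℝ n (fun x => ∫ t in (0 : ℝ)..1, t ^ k • F (t • x)) := by
  induction n with
  | zero =>
    intro G _ _ F hF k
    refine contDiff_zero.2 ?_
    exact (Differentiable.continuous (𝕜 := ℝ) fun x =>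
      (hasFDerivAt_integral_pow_smul_comp (hF.of_le (by simp)) k x).differentiableAt)
  | succ n ih =>
    intro G _ _ F hF k
    have h1 := hasFDerivAt_integral_pow_smul_comp (hF.of_le (by simp)) k
    push_cast
    refine contDiff_succ_iff_fderiv.2 ⟨fun x => (h1 x).differentiableAt, by simp, ?_⟩
    rw [funext fun x => (h1 x).fderiv]
    exact ih (hF.fderiv_right (by simp)) (k + 1)

/-- `∫₀¹ t³ f(t x) dt`. The vector field `x ↦ rayAverage f x • x` on `ℝ⁴` has divergence `f`. -/
noncomputable def rayAverage (f : E → ℂ) (x : E) : ℂ := ∫ t in (0 : ℝ)..1, t ^ 3 • f (t • x)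

theorem contDiff_rayAverage {f : E → ℂ} (hf : ContDiff ℝ ∞ f) : ContDiff ℝ ∞ (rayAverage f) :=
  contDiff_infty.2 fun n => contDiff_integral_pow_smul_comp n hf 3

/-- Integrating `d/dt (t⁴ f(tx)) = 4t³ f(tx) + t⁴ Df(tx)x` from `0` to `1` gives the identity. Its
left side is the divergence of `rayAverage f x • x` in dimension four. -/
theorem rayAverage_euler {f : E → ℂ} (hf : ContDiff ℝ ∞ f) (x : E) :
    4 * rayAverage f x + fderiv ℝ (rayAverage f) x x = f x := by
  have hf1 : ContDiff ℝ 1 f := hf.of_le (by simp)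
  have hfc := hf.continuous
  have hfc' : Continuous (fderiv ℝ f) := hf.continuous_fderiv (by simp)
  have h1 : fderiv ℝ (rayAverage f) x = ∫ t in (0 : ℝ)..1, t ^ 4 • fderiv ℝ f (t • x) :=
    (hasFDerivAt_integral_pow_smul_comp hf1 3 x).fderiv
  have h2 : (∫ t in (0 : ℝ)..1, t ^ 4 • fderiv ℝ f (t • x)) x
      = ∫ t in (0 : ℝ)..1, t ^ 4 • fderiv ℝ f (t • x) x := by
    exact ContinuousLinearMap.intervalIntegral_apply
      (φ := fun t : ℝ => t ^ 4 • fderiv ℝ f (t • x))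
      (Continuous.intervalIntegrable (by fun_prop) _ _) x
  have h3 : ∫ t in (0 : ℝ)..1, ((4 : ℂ) * (t ^ 3 • f (t • x)) + t ^ 4 • fderiv ℝ f (t • x) x)
      = (1 : ℝ) ^ 4 • f ((1 : ℝ) • x) - (0 : ℝ) ^ 4 • f ((0 : ℝ) • x) := by
    refine intervalIntegral.integral_eq_sub_of_hasDerivAt (f := fun t : ℝ => t ^ 4 • f (t • x))
      (fun t _ => ?_) (Continuous.intervalIntegrable (by fun_prop) _ _)
    have h4 : HasDerivAt (fun t : ℝ => t • x) x t := by
      simpa using (hasDerivAt_id t).smul_const x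
    have h5 := (hf1.differentiable (by simp) (t • x)).hasFDerivAt.comp_hasDerivAt t h4
    refine ((hasDerivAt_pow 4 t).fun_smul h5).congr_deriv ?_
    simp only [Complex.real_smul, Function.comp_apply]
    push_cast
    ring
  rw [h1, h2, rayAverage, ← intervalIntegral.integral_const_mul,
    ← intervalIntegral.integral_add (Continuous.intervalIntegrable (by fun_prop) _ _)
      (Continuous.intervalIntegrable (by fun_prop) _ _), h3]
  simp

end RadialAverage

/-! ### Cauchy–Schwarz, scaling and the dual Hardy inequality -/

theorem lintegral_sq_le {α : Type*} [MeasurableSpace α] {ν : Measure α} [IsProbabilityMeasure ν]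
    {g : α → ℝ≥0∞} (hg : AEMeasurable g ν) : (∫⁻ a, g a ∂ν) ^ 2 ≤ ∫⁻ a, g a ^ 2 ∂ν := by
  have h := ENNReal.lintegral_mul_le_Lp_mul_Lq ν Real.HolderConjugate.two_two hg
    (aemeasurable_const (b := (1 : ℝ≥0∞)))
  simp only [Pi.mul_apply, mul_one, lintegral_const, measure_univ, ENNReal.rpow_two, one_pow,
    ENNReal.one_rpow] at h
  calc (∫⁻ a, g a ∂ν) ^ 2 ≤ ((∫⁻ a, g a ^ 2 ∂ν) ^ (1 / 2 : ℝ)) ^ 2 := by gcongr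
    _ = ∫⁻ a, g a ^ 2 ∂ν := by
      rw [← ENNReal.rpow_natCast, ← ENNReal.rpow_mul]
      norm_num

theorem lintegral_mul_sq_le {α : Type*} [MeasurableSpace α] {ν : Measure α}
    {f g : α → ℝ≥0∞} (hf : AEMeasurable f ν) (hg : AEMeasurable g ν) :
    (∫⁻ a, f a * g a ∂ν) ^ 2 ≤ (∫⁻ a, f a ^ 2 ∂ν) * ∫⁻ a, g a ^ 2 ∂ν := by
  have h := ENNReal.lintegral_mul_le_Lp_mul_Lq ν Real.HolderConjugate.two_two hf hg
  simp only [Pi.mul_apply, ENNReal.rpow_two] at h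
  calc (∫⁻ a, f a * g a ∂ν) ^ 2
      ≤ ((∫⁻ a, f a ^ 2 ∂ν) ^ (1 / 2 : ℝ) * (∫⁻ a, g a ^ 2 ∂ν) ^ (1 / 2 : ℝ)) ^ 2 := by gcongr
    _ = (∫⁻ a, f a ^ 2 ∂ν) * ∫⁻ a, g a ^ 2 ∂ν := by
      rw [mul_pow, ← ENNReal.rpow_natCast, ← ENNReal.rpow_natCast, ← ENNReal.rpow_mul,
        ← ENNReal.rpow_mul]
      norm_num

theorem lintegral_comp_smul_euclidean {g : EuclideanSpace ℝ (Fin 4) → ℝ≥0∞} {t : ℝ} (ht : 0 < t) :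
    ∫⁻ x, g (t • x) = ENNReal.ofReal ((t ^ 4)⁻¹) * ∫⁻ x, g x := by
  have h1 : MeasurableEmbedding (fun x : EuclideanSpace ℝ (Fin 4) => t • x) :=
    (Homeomorph.smulOfNeZero t ht.ne').measurableEmbedding
  rw [← h1.lintegral_map, Measure.map_addHaar_smul _ ht.ne', lintegral_smul_measure]
  simp [abs_of_pos ht]

/-- Hardy's inequality in dual form: `‖|x| rayAverage f‖₂ ≤ ‖|x| f‖₂` on `ℝ⁴`. -/
theorem lintegral_rayAverage_le {f : EuclideanSpace ℝ (Fin 4) → ℂ} (hf : Continuous f) :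
    ∫⁻ x, (‖x‖ₑ * ‖rayAverage f x‖ₑ) ^ 2 ≤ ∫⁻ x, (‖x‖ₑ * ‖f x‖ₑ) ^ 2 := by
  let ν : Measure ℝ := volume.restrict (Set.Ioc 0 1)
  have hν : IsProbabilityMeasure ν := ⟨by simp [ν]⟩
  have h1 : ∀ x, (‖x‖ₑ * ‖rayAverage f x‖ₑ) ^ 2
      ≤ ∫⁻ t, (‖x‖ₑ * ‖t ^ 3 • f (t • x)‖ₑ) ^ 2 ∂ν := by
    intro x
    have hc : Continuous fun t : ℝ => t ^ 3 • f (t • x) := by fun_prop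
    calc (‖x‖ₑ * ‖rayAverage f x‖ₑ) ^ 2
        ≤ (‖x‖ₑ * ∫⁻ t, ‖t ^ 3 • f (t • x)‖ₑ ∂ν) ^ 2 := by
          gcongr
          rw [rayAverage, intervalIntegral.integral_of_le zero_le_one]
          exact enorm_integral_le_lintegral_enorm _
      _ = (∫⁻ t, ‖x‖ₑ * ‖t ^ 3 • f (t • x)‖ₑ ∂ν) ^ 2 := by
          rw [lintegral_const_mul _ hc.measurable.enorm]
      _ ≤ _ := lintegral_sq_le (hc.measurable.enorm.const_mul _).aemeasurable
  refine (lintegral_mono h1).trans ?_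
  have hc2 : Continuous fun p : EuclideanSpace ℝ (Fin 4) × ℝ => p.2 ^ 3 • f (p.2 • p.1) := by
    fun_prop
  rw [lintegral_lintegral_swap
    ((measurable_fst.enorm.mul hc2.measurable.enorm).pow_const 2).aemeasurable]
  -- The powers of `t` cancel: `t⁶` from `|t³ f|²`, `t⁻²` from rewriting `|x|²` as `t⁻²|tx|²`, and
  -- `t⁻⁴` from the Jacobian. Hence the constant is exactly one.
  have h2 : ∀ t ∈ Set.Ioc (0 : ℝ) 1, ∫⁻ x, (‖x‖ₑ * ‖t ^ 3 • f (t • x)‖ₑ) ^ 2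
      = ∫⁻ x, (‖x‖ₑ * ‖f x‖ₑ) ^ 2 := by
    intro t ht
    have h3 : ∀ x : EuclideanSpace ℝ (Fin 4), (‖x‖ₑ * ‖t ^ 3 • f (t • x)‖ₑ) ^ 2
        = ENNReal.ofReal (t ^ 4) * (‖t • x‖ₑ * ‖f (t • x)‖ₑ) ^ 2 := by
      intro x
      have h4 : ‖t‖ₑ = ENNReal.ofReal t := Real.enorm_of_nonneg ht.1.le
      rw [enorm_smul, enorm_smul, enorm_pow, h4, ENNReal.ofReal_pow ht.1.le]
      ring
    simp only [h3]
    rw [lintegral_const_mul' _ _ ENNReal.ofReal_ne_top,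
      lintegral_comp_smul_euclidean (g := fun y => (‖y‖ₑ * ‖f y‖ₑ) ^ 2) ht.1, ← mul_assoc,
      ← ENNReal.ofReal_mul (by positivity [ht.1]), mul_inv_cancel₀ (pow_ne_zero 4 ht.1.ne'),
      ENNReal.ofReal_one, one_mul]
  rw [setLIntegral_congr_fun measurableSet_Ioc h2]
  simp

/-! ### Hardy's inequality near the origin -/

theorem lintegral_enorm_sq_Lp {α : Type*} [MeasurableSpace α] {ν : Measure α} (f : Lp ℂ 2 ν) :
    ∫⁻ x, ‖f x‖ₑ ^ 2 ∂ν = ‖f‖ₑ ^ 2 := by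
  rw [Lp.enorm_def, eLpNorm_eq_lintegral_rpow_enorm_toReal two_ne_zero ENNReal.ofNat_ne_top]
  simp only [ENNReal.toReal_ofNat, ENNReal.rpow_two]
  rw [← ENNReal.rpow_natCast, ← ENNReal.rpow_mul]
  norm_num

theorem integrable_norm_sq_Lp {α : Type*} [MeasurableSpace α] {ν : Measure α} (f : Lp ℂ 2 ν) :
    Integrable (fun x => ‖f x‖ ^ 2) ν :=
  (memLp_two_iff_integrable_sq_norm (Lp.aestronglyMeasurable f)).1 (Lp.memLp f)

theorem integral_norm_sq_Lp {α : Type*} [MeasurableSpace α] {ν : Measure α} (f : Lp ℂ 2 ν) :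
    ∫ x, ‖f x‖ ^ 2 ∂ν = ‖f‖ ^ 2 := by
  have h : (inner ℂ f f : ℂ) = ((∫ x, ‖f x‖ ^ 2 ∂ν : ℝ) : ℂ) := by
    rw [L2.inner_def, ← integral_complex_ofReal]
    refine integral_congr_ae (Eventually.of_forall fun x => ?_)
    simp only [inner_self_eq_norm_sq_to_K, Complex.coe_algebraMap, Complex.ofReal_pow]
  rw [inner_self_eq_norm_sq_to_K] at h
  exact Complex.ofReal_injective (by rw [← h]; simp)

theorem EuclideanSpace.sum_smul_apply_single {n : ℕ} {F : Type*} [NormedAddCommGroup F]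
    [NormedSpace ℝ F] (L : EuclideanSpace ℝ (Fin n) →L[ℝ] F) (x : EuclideanSpace ℝ (Fin n)) :
    ∑ i, x i • L (EuclideanSpace.single i 1) = L x := by
  have h := (EuclideanSpace.basisFun (Fin n) ℝ).sum_repr x
  conv_rhs => rw [← h]
  simp

namespace Slab

theorem integrable_test_mul {R : ℝ} {φ : EuclideanSpace ℝ (Fin 4) → ℂ} (hφ : Continuous φ)
    (hc : HasCompactSupport φ) (ψ : L2 R) : Integrable (fun x => φ x * ψ x) (μ R) := by
  have h1 : MemLp φ 2 (μ R) := (hφ.memLp_of_hasCompactSupport hc).restrict _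
  exact memLp_one_iff_integrable.1 ((Lp.memLp ψ).smul (r := 1) h1)

/-- Weak derivatives are defined with real test functions; complex ones follow from their real and
imaginary parts. -/
theorem HasWeakPartial.integral_mul {R : ℝ} {i : Fin 4} {ψ g : L2 R} (h : HasWeakPartial R i ψ g)
    {φ : EuclideanSpace ℝ (Fin 4) → ℂ} (hφ : ContDiff ℝ ∞ φ) (hc : HasCompactSupport φ)
    (hs : tsupport φ ⊆ Ω R) :
    ∫ x in Ω R, pderiv i φ x * ψ x = - ∫ x in Ω R, φ x * g x := by
  have key : ∀ L : ℂ →L[ℝ] ℝ, ∫ x in Ω R, L (pderiv i φ x) • ψ x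
      = - ∫ x in Ω R, L (φ x) • g x ∧ Integrable (fun x => L (pderiv i φ x) • ψ x) (μ R) ∧
      Integrable (fun x => L (φ x) • g x) (μ R) := by
    intro L
    have h1 : ∀ x, pderiv i (fun x => L (φ x)) x = L (pderiv i φ x) := fun x => by
      have := (L.hasFDerivAt.comp x (hφ.differentiable (by simp) x).hasFDerivAt).fderiv
      change fderiv ℝ (L ∘ φ) x _ = _
      rw [this]
      rfl
    have h2 : ContDiff ℝ ∞ fun x => L (φ x) := L.contDiff.comp hφ
    have h3 : HasCompactSupport fun x => L (φ x) := hc.comp_left (map_zero L)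
    have h4 := h (fun x => L (φ x)) h2 h3 ((tsupport_comp_subset (map_zero L) φ).trans hs)
    have h5 := integrable_test_smul (continuous_pderiv h2 i) (hasCompactSupport_pderiv h3 i) ψ
    simp only [h1] at h4 h5
    exact ⟨h4, h5, integrable_test_smul h2.continuous h3 g⟩
  have split : ∀ (a b : EuclideanSpace ℝ (Fin 4) → ℂ),
      Integrable (fun x => Complex.reCLM (a x) • b x) (μ R) →
      Integrable (fun x => Complex.imCLM (a x) • b x) (μ R) →
      ∫ x in Ω R, a x * b x = (∫ x in Ω R, Complex.reCLM (a x) • b x)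
        + Complex.I * ∫ x in Ω R, Complex.imCLM (a x) • b x := by
    intro a b h1 h2
    rw [← integral_const_mul, ← integral_add h1 (h2.const_mul _)]
    refine integral_congr_ae (Eventually.of_forall fun x => ?_)
    simp only [Complex.reCLM_apply, Complex.imCLM_apply, Complex.real_smul]
    nth_rewrite 1 [← Complex.re_add_im (a x)]
    ring
  obtain ⟨a1, a2, a3⟩ := key Complex.reCLM
  obtain ⟨b1, b2, b3⟩ := key Complex.imCLM
  rw [split _ _ a2 b2, split _ _ a3 b3, a1, b1]
  ring

/-- Testing the weak gradient against the vector field `χ (rayAverage f) x`, whose divergence is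
`χ f` up to a term with `∇χ`. -/
theorem integral_cutoff_mul {R : ℝ} (ψ : W12 R) {χ : EuclideanSpace ℝ (Fin 4) → ℝ}
    (hχ : ContDiff ℝ ∞ χ) (hχc : HasCompactSupport χ) (hχs : tsupport χ ⊆ Ω R)
    {f : EuclideanSpace ℝ (Fin 4) → ℂ} (hf : ContDiff ℝ ∞ f) :
    ∫ x in Ω R, χ x * f x * (ψ : L2 R) x = - ∫ x in Ω R,
      (fderiv ℝ χ x x * rayAverage f x * (ψ : L2 R) x
        + ∑ i, χ x * x i * rayAverage f x * weakPartial R i ψ x) := by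
  have hI := contDiff_rayAverage hf
  have hx : ∀ i : Fin 4, ContDiff ℝ ∞ fun x : EuclideanSpace ℝ (Fin 4) => x i := fun i => by fun_prop
  have hr : ∀ i : Fin 4, ContDiff ℝ ∞ fun x : EuclideanSpace ℝ (Fin 4) => χ x * x i :=
    fun i => hχ.mul (hx i)
  let φ : Fin 4 → EuclideanSpace ℝ (Fin 4) → ℂ := fun i x => (χ x * x i) • rayAverage f x
  have hφ : ∀ i, ContDiff ℝ ∞ (φ i) := fun i => (hr i).smul hI
  have hsub : ∀ i, Function.support (φ i) ⊆ Function.support χ := fun i x hx h0 => by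
    simp [φ, h0] at hx
  have hφc : ∀ i, HasCompactSupport (φ i) := fun i => hχc.mono (hsub i)
  have hφs : ∀ i, tsupport (φ i) ⊆ Ω R := fun i => (closure_mono (hsub i)).trans hχs
  have hd : ∀ x, ∑ i, pderiv i (φ i) x = χ x * f x + fderiv ℝ χ x x * rayAverage f x := by
    intro x
    have h1 : ∀ i, pderiv i (φ i) x = (χ x : ℂ) * rayAverage f x
        + (x i • fderiv ℝ χ x (EuclideanSpace.single i 1) : ℝ) * rayAverage f x
        + χ x * (x i • fderiv ℝ (rayAverage f) x (EuclideanSpace.single i 1)) := by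
      intro i
      have e1 := (hχ.differentiable (by simp) x).hasFDerivAt
      have e2 := (EuclideanSpace.proj i : EuclideanSpace ℝ (Fin 4) →L[ℝ] ℝ).hasFDerivAt (x := x)
      have e3 := (e1.mul e2).smul (hI.differentiable (by simp) x).hasFDerivAt
      have e4 : fderiv ℝ (φ i) x = _ := e3.fderiv
      rw [pderiv, e4]
      simp
      ring
    simp only [h1, Finset.sum_add_distrib, ← Finset.mul_sum, ← Finset.sum_mul,
      ← Complex.ofReal_sum, EuclideanSpace.sum_smul_apply_single]
    rw [← rayAverage_euler hf x]
    simp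
    ring
  have h1 : ∫ x in Ω R, ∑ i, pderiv i (φ i) x * (ψ : L2 R) x
      = - ∫ x in Ω R, ∑ i, φ i x * weakPartial R i ψ x := by
    rw [integral_finsetSum _ fun i _ => integrable_test_mul (continuous_pderiv' (hφ i) i)
        ((hφc i).fderiv_apply ℝ _) _,
      integral_finsetSum _ fun i _ => integrable_test_mul (hφ i).continuous (hφc i) _,
      ← Finset.sum_neg_distrib]
    exact Finset.sum_congr rfl fun i _ =>
      (weakPartial_spec R i ψ).integral_mul (hφ i) (hφc i) (hφs i)
  simp only [← Finset.sum_mul, hd, add_mul] at h1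
  have hcC : HasCompactSupport fun x => (χ x : ℂ) := hχc.comp_left Complex.ofReal_zero
  have hdC : HasCompactSupport fun x : EuclideanSpace ℝ (Fin 4) => ((fderiv ℝ χ x x : ℝ) : ℂ) := by
    refine (hχc.fderiv ℝ).mono fun x hx h0 => hx ?_
    simp [h0]
  have c1 : Continuous fun x => fderiv ℝ χ x x :=
    (hχ.continuous_fderiv (by simp)).clm_apply continuous_id
  have c2 := hχ.continuous
  have c3 := hf.continuous
  have c4 := hI.continuous
  have i1 : Integrable (fun x => χ x * f x * (ψ : L2 R) x) (μ R) :=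
    integrable_test_mul (φ := fun x => χ x * f x) (by fun_prop) hcC.mul_right _
  have i2 : Integrable (fun x => fderiv ℝ χ x x * rayAverage f x * (ψ : L2 R) x) (μ R) :=
    integrable_test_mul (φ := fun x => fderiv ℝ χ x x * rayAverage f x)
      (by fun_prop) hdC.mul_right _
  have i3 : Integrable (fun x => ∑ i, φ i x * weakPartial R i ψ x) (μ R) :=
    integrable_finsetSum _ fun i _ => integrable_test_mul (hφ i).continuous (hφc i) _
  rw [integral_add i1 i2] at h1
  have h2 : ∫ x in Ω R, (fderiv ℝ χ x x * rayAverage f x * (ψ : L2 R) x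
      + ∑ i, χ x * x i * rayAverage f x * weakPartial R i ψ x)
      = (∫ x in Ω R, fderiv ℝ χ x x * rayAverage f x * (ψ : L2 R) x)
        + ∫ x in Ω R, ∑ i, φ i x * weakPartial R i ψ x := by
    rw [← integral_add i2 i3]
    simp [φ]
  rw [h2]
  linear_combination h1

/-- The majorant `M |ψ| + |∇ψ|` of `|∇(χψ)|`. -/
noncomputable def gradMajorant {R : ℝ} (M : ℝ) (ψ : W12 R) (x : EuclideanSpace ℝ (Fin 4)) : ℝ :=
  M * ‖(ψ : L2 R) x‖ + √(gradSq ψ x)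

theorem gradSq_nonneg {R : ℝ} (ψ : W12 R) (x : EuclideanSpace ℝ (Fin 4)) : 0 ≤ gradSq ψ x :=
  Finset.sum_nonneg fun _ _ => sq_nonneg _

theorem integrable_gradSq {R : ℝ} (ψ : W12 R) : Integrable (gradSq ψ) (μ R) :=
  integrable_finsetSum _ fun _ _ => integrable_norm_sq_Lp _

theorem aestronglyMeasurable_gradMajorant {R : ℝ} (M : ℝ) (ψ : W12 R) :
    AEStronglyMeasurable (gradMajorant M ψ) (μ R) :=
  ((Lp.aestronglyMeasurable _).norm.const_mul M).add
    (Real.continuous_sqrt.comp_aestronglyMeasurable (integrable_gradSq ψ).1)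

/-- Young's inequality `2ab ≤ εb² + ε⁻¹a²` puts almost all the weight on the gradient, so the
leading constant stays arbitrarily close to one. -/
theorem gradMajorant_sq_le {R ε : ℝ} (hε : 0 < ε) (M : ℝ) (ψ : W12 R)
    (x : EuclideanSpace ℝ (Fin 4)) :
    gradMajorant M ψ x ^ 2 ≤ (1 + ε) * gradSq ψ x + (1 + ε⁻¹) * M ^ 2 * ‖(ψ : L2 R) x‖ ^ 2 := by
  have h1 := Real.sq_sqrt (gradSq_nonneg ψ x)
  rw [gradMajorant]
  set a := M * ‖(ψ : L2 R) x‖ with ha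
  set b := √(gradSq ψ x)
  have h2 : 2 * a * b ≤ ε * b ^ 2 + ε⁻¹ * a ^ 2 := by
    have h3 : 0 ≤ ε⁻¹ * (ε * b - a) ^ 2 := by positivity
    have h4 : ε⁻¹ * (ε * b - a) ^ 2 = ε * b ^ 2 + ε⁻¹ * a ^ 2 - 2 * a * b := by
      field_simp
      ring
    linarith
  rw [← h1]
  have h5 : (1 + ε⁻¹) * M ^ 2 * ‖(ψ : L2 R) x‖ ^ 2 = (1 + ε⁻¹) * a ^ 2 := by rw [ha]; ring
  rw [h5]
  nlinarith

theorem integrable_gradMajorant_sq {R : ℝ} (M : ℝ) (ψ : W12 R) :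
    Integrable (fun x => gradMajorant M ψ x ^ 2) (μ R) := by
  refine (((integrable_gradSq ψ).const_mul (1 + 1)).add
    ((integrable_norm_sq_Lp (ψ : L2 R)).const_mul ((1 + 1⁻¹) * M ^ 2))).mono'
    ((aestronglyMeasurable_gradMajorant M ψ).pow 2) (Eventually.of_forall fun x => ?_)
  rw [Real.norm_of_nonneg (sq_nonneg _)]
  exact gradMajorant_sq_le one_pos M ψ x

theorem integral_gradMajorant_sq_le {R ε : ℝ} (hε : 0 < ε) (M : ℝ) (ψ : W12 R) :
    ∫ x in Ω R, gradMajorant M ψ x ^ 2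
      ≤ (1 + ε) * (∫ x in Ω R, gradSq ψ x) + (1 + ε⁻¹) * M ^ 2 * ‖(ψ : L2 R)‖ ^ 2 := by
  have i1 := (integrable_gradSq ψ).const_mul (1 + ε)
  have i2 := (integrable_norm_sq_Lp (ψ : L2 R)).const_mul ((1 + ε⁻¹) * M ^ 2)
  rw [← integral_norm_sq_Lp, ← integral_const_mul, ← integral_const_mul, ← integral_add i1 i2]
  exact integral_mono (integrable_gradMajorant_sq M ψ) (i1.add i2)
    (gradMajorant_sq_le hε M ψ)

/-- Cauchy–Schwarz pairs `|x| |rayAverage f|`, controlled by the dual Hardy inequality, with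
`gradMajorant`. The cutoff term also carries the factor `|x|`, since `|Dχ(x)x| ≤ M|x|`. -/
theorem enorm_integral_cutoff_mul_sq_le {R M : ℝ} (ψ : W12 R) {χ : EuclideanSpace ℝ (Fin 4) → ℝ}
    (hχ : ContDiff ℝ ∞ χ) (hχc : HasCompactSupport χ) (hχs : tsupport χ ⊆ Ω R)
    (hχ1 : ∀ x, |χ x| ≤ 1) (hM : ∀ x, ‖fderiv ℝ χ x‖ ≤ M)
    {f : EuclideanSpace ℝ (Fin 4) → ℂ} (hf : ContDiff ℝ ∞ f) :
    ‖∫ x in Ω R, χ x * f x * (ψ : L2 R) x‖ₑ ^ 2 ≤ (∫⁻ x, (‖x‖ₑ * ‖f x‖ₑ) ^ 2) *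
      ENNReal.ofReal (∫ x in Ω R, gradMajorant M ψ x ^ 2) := by
  have hM0 : 0 ≤ M := (norm_nonneg _).trans (hM 0)
  have hB0 : ∀ x, 0 ≤ gradMajorant M ψ x := fun x => by unfold gradMajorant; positivity
  have hpt : ∀ x, ‖fderiv ℝ χ x x * rayAverage f x * (ψ : L2 R) x
      + ∑ i, χ x * x i * rayAverage f x * weakPartial R i ψ x‖
      ≤ (‖x‖ * ‖rayAverage f x‖) * gradMajorant M ψ x := by
    intro x
    have h1 : ‖∑ i, ((x i : ℝ) : ℂ) * weakPartial R i ψ x‖ ≤ ‖x‖ * √(gradSq ψ x) := by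
      refine (norm_sum_le _ _).trans ?_
      rw [EuclideanSpace.norm_eq, gradSq]
      simp only [norm_mul, Complex.norm_real]
      exact Real.sum_mul_le_sqrt_mul_sqrt _ _ _
    have h2 : ∑ i, χ x * x i * rayAverage f x * weakPartial R i ψ x
        = χ x * rayAverage f x * ∑ i, ((x i : ℝ) : ℂ) * weakPartial R i ψ x := by
      rw [Finset.mul_sum]
      exact Finset.sum_congr rfl fun i _ => by ring
    have h3 : |fderiv ℝ χ x x| ≤ M * ‖x‖ :=
      ((fderiv ℝ χ x).le_opNorm x).trans (by gcongr; exact hM x)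
    refine (norm_add_le _ _).trans ?_
    rw [h2, norm_mul, norm_mul, norm_mul, norm_mul, Complex.norm_real, Complex.norm_real,
      Real.norm_eq_abs, Real.norm_eq_abs, gradMajorant]
    calc |fderiv ℝ χ x x| * ‖rayAverage f x‖ * ‖(ψ : L2 R) x‖
          + |χ x| * ‖rayAverage f x‖ * ‖∑ i, ((x i : ℝ) : ℂ) * weakPartial R i ψ x‖
        ≤ (M * ‖x‖) * ‖rayAverage f x‖ * ‖(ψ : L2 R) x‖
          + 1 * ‖rayAverage f x‖ * (‖x‖ * √(gradSq ψ x)) := by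
          gcongr
          exact hχ1 x
      _ = _ := by ring
  have hI := (contDiff_rayAverage hf).continuous
  rw [integral_cutoff_mul ψ hχ hχc hχs hf, enorm_neg]
  calc _ ≤ (∫⁻ x in Ω R, (‖x‖ₑ * ‖rayAverage f x‖ₑ) * ENNReal.ofReal (gradMajorant M ψ x)) ^ 2 := by
        gcongr
        refine (enorm_integral_le_lintegral_enorm _).trans (lintegral_mono fun x => ?_)
        rw [← ofReal_norm, ← ofReal_norm, ← ofReal_norm, ← ENNReal.ofReal_mul (norm_nonneg _),
          ← ENNReal.ofReal_mul (by positivity)]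
        exact ENNReal.ofReal_le_ofReal (hpt x)
    _ ≤ (∫⁻ x in Ω R, (‖x‖ₑ * ‖rayAverage f x‖ₑ) ^ 2) *
        ∫⁻ x in Ω R, ENNReal.ofReal (gradMajorant M ψ x) ^ 2 :=
        lintegral_mul_sq_le (measurable_enorm.mul hI.measurable.enorm).aemeasurable
          (aestronglyMeasurable_gradMajorant M ψ).aemeasurable.ennreal_ofReal
    _ ≤ _ := by
        refine mul_le_mul' ?_ ?_
        · exact (setLIntegral_le_lintegral _ _).trans (lintegral_rayAverage_le hf.continuous)
        · rw [ofReal_integral_eq_lintegral_ofReal (integrable_gradMajorant_sq M ψ)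
            (Eventually.of_forall fun _ => sq_nonneg _)]
          simp only [ENNReal.ofReal_pow (hB0 _)]
          exact le_rfl

end Slab

/-! ### From the dual estimate to the weight `1/|x|²` -/

namespace Slab

/-- The norm of `u = χ m ψ`, where `m = (|x|² + δ)^(-1/2)`, is found by duality. Regularization
keeps `m` smooth, so `m g̅` is an admissible `f` for every smooth `g`, while the bound does not
depend on `δ`. -/
theorem lintegral_cutoff_regularized_le {R M δ : ℝ} (hδ : 0 < δ) (ψ : W12 R)
    {χ : EuclideanSpace ℝ (Fin 4) → ℝ}
    (hχ : ContDiff ℝ ∞ χ) (hχc : HasCompactSupport χ) (hχs : tsupport χ ⊆ Ω R)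
    (hχ1 : ∀ x, |χ x| ≤ 1) (hM : ∀ x, ‖fderiv ℝ χ x‖ ≤ M) :
    ∫⁻ x in Ω R, ENNReal.ofReal ((χ x * ‖(ψ : L2 R) x‖) ^ 2 / (‖x‖ ^ 2 + δ)) ≤
      ENNReal.ofReal (∫ x in Ω R, gradMajorant M ψ x ^ 2) := by
  have hpos : ∀ x : EuclideanSpace ℝ (Fin 4), 0 < ‖x‖ ^ 2 + δ := fun x => by positivity
  let m : EuclideanSpace ℝ (Fin 4) → ℝ := fun x => (√(‖x‖ ^ 2 + δ))⁻¹
  have hm : ContDiff ℝ ∞ m :=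
    (((contDiff_norm_sq ℝ).add contDiff_const).sqrt fun x => (hpos x).ne').inv
      fun x => (Real.sqrt_pos.2 (hpos x)).ne'
  have hm2 : ∀ x, m x ^ 2 = (‖x‖ ^ 2 + δ)⁻¹ := fun x => by
    rw [inv_pow, Real.sq_sqrt (hpos x).le]
  have hc : Continuous fun x => ((χ x * m x : ℝ) : ℂ) :=
    Complex.continuous_ofReal.comp (hχ.continuous.mul hm.continuous)
  have hcc : HasCompactSupport fun x => ((χ x * m x : ℝ) : ℂ) :=
    (hχc.mul_right).comp_left Complex.ofReal_zero
  have huM : MemLp (fun x => ((χ x * m x : ℝ) : ℂ) * (ψ : L2 R) x) 2 (μ R) := by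
    have h1 : MemLp (fun x => ((χ x * m x : ℝ) : ℂ)) ∞ (μ R) :=
      (hc.memLp_of_hasCompactSupport hcc).restrict _
    exact (Lp.memLp (ψ : L2 R)).smul (r := 2) h1
  -- Extension by zero to `ℝ⁴`, where smooth compactly supported functions are dense in `L²`.
  have huM' := (memLp_indicator_iff_restrict (isOpen_Ω R).measurableSet).2 huM
  set u := huM'.toLp with hu
  have huae := huM'.coeFn_toLp
  set A := ∫ x in Ω R, gradMajorant M ψ x ^ 2 with hA
  have hA0 : 0 ≤ A := integral_nonneg fun _ => sq_nonneg _
  have hbound : ∀ k : Lp ℂ 2 (volume : Measure (EuclideanSpace ℝ (Fin 4))),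
      ‖inner ℂ k u‖ ≤ ‖k‖ * √A := by
    have hcl : IsClosed {k : Lp ℂ 2 (volume : Measure (EuclideanSpace ℝ (Fin 4))) |
        ‖inner ℂ k u‖ ≤ ‖k‖ * √A} := isClosed_le (by fun_prop) (by fun_prop)
    have hd := Lp.dense_hasCompactSupport_contDiff (E := EuclideanSpace ℝ (Fin 4)) (F := ℂ)
      (μ := volume) (p := 2) (by norm_num)
    refine fun k => hcl.closure_subset_iff.2 (fun k hk => ?_) (hd k)
    obtain ⟨g, hg, hgc, hgs⟩ := hk
    have hf : ContDiff ℝ ∞ fun x => (m x : ℂ) * starRingEnd ℂ (g x) :=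
      (Complex.ofRealCLM.contDiff.comp hm).mul (Complex.conjCLE.contDiff.comp hgs)
    have h1 := enorm_integral_cutoff_mul_sq_le ψ hχ hχc hχs hχ1 hM hf
    have h2 : ∫ x in Ω R, χ x * ((m x : ℂ) * starRingEnd ℂ (g x)) * (ψ : L2 R) x
        = inner ℂ k u := by
      rw [L2.inner_def, ← integral_indicator (isOpen_Ω R).measurableSet]
      refine integral_congr_ae ?_
      filter_upwards [hg, huae] with x hx hx'
      rw [hx, hx']
      by_cases hxΩ : x ∈ Ω R
      · simp only [Set.indicator_of_mem hxΩ, RCLike.inner_apply]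
        push_cast
        ring
      · simp [Set.indicator_of_notMem hxΩ]
    -- Here `|x| m(x) ≤ 1`, so the weighted norm of `f` is at most the norm of `g`.
    have h3 : ∫⁻ x, (‖x‖ₑ * ‖(m x : ℂ) * starRingEnd ℂ (g x)‖ₑ) ^ 2 ≤ ‖k‖ₑ ^ 2 := by
      rw [← lintegral_enorm_sq_Lp]
      refine lintegral_mono_ae ?_
      filter_upwards [hg] with x hx
      rw [hx]
      gcongr
      rw [← ofReal_norm, ← ofReal_norm, ← ofReal_norm, ← ENNReal.ofReal_mul (norm_nonneg _)]
      refine ENNReal.ofReal_le_ofReal ?_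
      rw [norm_mul, RCLike.norm_conj, Complex.norm_real, ← mul_assoc]
      refine mul_le_of_le_one_left (norm_nonneg _) ?_
      have hmx : ‖m x‖ = (√(‖x‖ ^ 2 + δ))⁻¹ :=
        Real.norm_of_nonneg (inv_nonneg.2 (Real.sqrt_nonneg _))
      rw [hmx, ← div_eq_mul_inv, div_le_one (Real.sqrt_pos.2 (hpos x))]
      exact Real.le_sqrt_of_sq_le (by linarith)
    rw [h2] at h1
    have h4 := h1.trans (mul_le_mul_left h3 _)
    rw [← ofReal_norm, ← ofReal_norm, ← ENNReal.ofReal_pow (norm_nonneg _),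
      ← ENNReal.ofReal_pow (norm_nonneg _), ← ENNReal.ofReal_mul (by positivity),
      ENNReal.ofReal_le_ofReal_iff (by positivity)] at h4
    refine (sq_le_sq₀ (norm_nonneg _) (mul_nonneg (norm_nonneg _) (Real.sqrt_nonneg _))).1 ?_
    rw [mul_pow, Real.sq_sqrt hA0]
    exact h4
  have hunorm : ‖u‖ ^ 2 ≤ A := by
    have h1 := hbound u
    rw [inner_self_eq_norm_sq_to_K, norm_pow, RCLike.norm_ofReal, abs_norm, sq] at h1
    have h2 : ‖u‖ ≤ √A := by
      by_contra! h3
      have h4 : 0 < ‖u‖ := (Real.sqrt_nonneg _).trans_lt h3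
      nlinarith
    calc ‖u‖ ^ 2 ≤ √A ^ 2 := by gcongr
      _ = A := Real.sq_sqrt hA0
  calc ∫⁻ x in Ω R, ENNReal.ofReal ((χ x * ‖(ψ : L2 R) x‖) ^ 2 / (‖x‖ ^ 2 + δ))
      = ∫⁻ x, ‖u x‖ₑ ^ 2 := by
        rw [← lintegral_indicator (isOpen_Ω R).measurableSet]
        refine lintegral_congr_ae ?_
        filter_upwards [huae] with x hx
        rw [hx]
        by_cases hxΩ : x ∈ Ω R
        · simp only [Set.indicator_of_mem hxΩ]
          rw [← ofReal_norm, ← ENNReal.ofReal_pow (norm_nonneg _), norm_mul, Complex.norm_real,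
            Real.norm_eq_abs, mul_pow, mul_pow, sq_abs, mul_pow, hm2]
          congr 1
          ring
        · simp [Set.indicator_of_notMem hxΩ]
    _ = ‖u‖ₑ ^ 2 := lintegral_enorm_sq_Lp u
    _ ≤ ENNReal.ofReal A := by
        rw [← ofReal_norm, ← ENNReal.ofReal_pow (norm_nonneg _)]
        exact ENNReal.ofReal_le_ofReal hunorm

/-- Fatou's lemma as `δ = 1/(n + 1)` tends to zero; the regularized bounds are uniform in `n`. -/
theorem lintegral_cutoff_div_le {R M : ℝ} (ψ : W12 R)
    {χ : EuclideanSpace ℝ (Fin 4) → ℝ}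
    (hχ : ContDiff ℝ ∞ χ) (hχc : HasCompactSupport χ) (hχs : tsupport χ ⊆ Ω R)
    (hχ1 : ∀ x, |χ x| ≤ 1) (hM : ∀ x, ‖fderiv ℝ χ x‖ ≤ M) :
    ∫⁻ x in Ω R, ENNReal.ofReal ((χ x * ‖(ψ : L2 R) x‖) ^ 2 / ‖x‖ ^ 2) ≤
      ENNReal.ofReal (∫ x in Ω R, gradMajorant M ψ x ^ 2) := by
  let F : ℕ → EuclideanSpace ℝ (Fin 4) → ℝ≥0∞ := fun n x =>
    ENNReal.ofReal ((χ x * ‖(ψ : L2 R) x‖) ^ 2 / (‖x‖ ^ 2 + 1 / ((n : ℝ) + 1)))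
  have hlim : ∀ᵐ x ∂(μ R), ENNReal.ofReal ((χ x * ‖(ψ : L2 R) x‖) ^ 2 / ‖x‖ ^ 2)
      = liminf (fun n => F n x) atTop := by
    have h0 : ∀ᵐ x ∂(μ R), x ≠ 0 :=
      ae_restrict_of_ae (Measure.ae_ne volume 0)
    filter_upwards [h0] with x hx
    refine (Tendsto.liminf_eq ?_).symm
    refine ENNReal.tendsto_ofReal (tendsto_const_nhds.div ?_ (by positivity))
    simpa using tendsto_one_div_add_atTop_nhds_zero_nat.const_add (‖x‖ ^ 2)
  rw [lintegral_congr_ae hlim]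
  refine (lintegral_liminf_le' fun n => ?_).trans ?_
  · refine AEMeasurable.ennreal_ofReal (AEMeasurable.div ?_ (by fun_prop))
    exact (hχ.continuous.measurable.aemeasurable.mul
      (Lp.aestronglyMeasurable (ψ : L2 R)).norm.aemeasurable).pow_const 2
  · refine liminf_le_of_le (by isBoundedDefault) fun b hb => ?_
    obtain ⟨n, hn⟩ := hb.exists
    exact hn.trans (lintegral_cutoff_regularized_le (by positivity) ψ hχ hχc hχs hχ1 hM)

theorem exists_cutoff {R : ℝ} (hR : 0 < R) : ∃ (χ : EuclideanSpace ℝ (Fin 4) → ℝ) (r M : ℝ),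
    ContDiff ℝ ∞ χ ∧ HasCompactSupport χ ∧ tsupport χ ⊆ Ω R ∧ (∀ x, |χ x| ≤ 1) ∧
    (∀ x, ‖fderiv ℝ χ x‖ ≤ M) ∧ 0 < r ∧ ∀ x, ‖x‖ ≤ r → χ x = 1 := by
  have hp : 0 < Real.pi * R := by positivity
  -- The outer radius `πR/2` keeps the support of the bump strictly inside the slab.
  let χ : ContDiffBump (0 : EuclideanSpace ℝ (Fin 4)) :=
    ⟨Real.pi * R / 4, Real.pi * R / 2, by positivity, by linarith⟩
  have hs : ContDiff ℝ ∞ χ := χ.contDiff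
  obtain ⟨M, hM⟩ := (χ.hasCompactSupport.fderiv ℝ).exists_bound_of_continuous
    (hs.continuous_fderiv (by simp))
  refine ⟨χ, Real.pi * R / 4, M, hs, χ.hasCompactSupport, ?_, fun x => ?_, hM, by positivity,
    fun x hx => χ.one_of_mem_closedBall (by simpa using hx)⟩
  · rw [χ.tsupport_eq]
    intro x hx
    have h1 : |x 3| ≤ Real.pi * R / 2 := by
      have h2 : ‖x‖ ≤ Real.pi * R / 2 := by simpa using hx
      exact (PiLp.norm_apply_le x 3).trans h2
    have h2 := abs_le.1 h1
    exact ⟨by linarith [h2.1], by linarith [h2.2]⟩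
  · rw [abs_of_nonneg χ.nonneg]
    exact χ.le_one

/-- Hardy's inequality on the slab, with the lower order term produced by localization. -/
theorem hardy {R : ℝ} (hR : 0 < R) {ε : ℝ} (hε : 0 < ε) : ∃ C : ℝ, 0 ≤ C ∧ ∀ ψ : W12 R,
    Integrable (fun x => ‖(ψ : L2 R) x‖ ^ 2 / ‖x‖ ^ 2) (μ R) ∧
    ∫ x in Ω R, ‖(ψ : L2 R) x‖ ^ 2 / ‖x‖ ^ 2 ≤
      (1 + ε) * (∫ x in Ω R, gradSq ψ x) + C * ‖(ψ : L2 R)‖ ^ 2 := by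
  obtain ⟨χ, r, M, hχ, hχc, hχs, hχ1, hM, hr, hχr⟩ := exists_cutoff hR
  -- The first constant is the price of the cutoff in `gradMajorant_sq_le`; the second bounds
  -- `1/|x|²` outside the ball where `χ = 1`.
  refine ⟨(1 + ε⁻¹) * M ^ 2 + (r ^ 2)⁻¹, by positivity, fun ψ => ?_⟩
  have hA := lintegral_cutoff_div_le ψ hχ hχc hχs hχ1 hM
  set A := ∫ x in Ω R, gradMajorant M ψ x ^ 2 with hAdef
  have hA0 : 0 ≤ A := integral_nonneg fun _ => sq_nonneg _
  have hpt : ∀ x : EuclideanSpace ℝ (Fin 4), ‖(ψ : L2 R) x‖ ^ 2 / ‖x‖ ^ 2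
      ≤ (χ x * ‖(ψ : L2 R) x‖) ^ 2 / ‖x‖ ^ 2 + (r ^ 2)⁻¹ * ‖(ψ : L2 R) x‖ ^ 2 := by
    intro x
    rcases le_or_gt ‖x‖ r with h | h
    · rw [hχr x h, one_mul]
      have : 0 ≤ (r ^ 2)⁻¹ * ‖(ψ : L2 R) x‖ ^ 2 := by positivity
      linarith
    · have h1 : 0 ≤ (χ x * ‖(ψ : L2 R) x‖) ^ 2 / ‖x‖ ^ 2 := by positivity
      have h2 : ‖(ψ : L2 R) x‖ ^ 2 / ‖x‖ ^ 2 ≤ (r ^ 2)⁻¹ * ‖(ψ : L2 R) x‖ ^ 2 := by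
        rw [div_eq_inv_mul]
        gcongr
      linarith
  have hmeas : AEStronglyMeasurable (fun x => ‖(ψ : L2 R) x‖ ^ 2 / ‖x‖ ^ 2) (μ R) :=
    (((Lp.aestronglyMeasurable (ψ : L2 R)).norm.aemeasurable.pow_const 2).div
      (by fun_prop)).aestronglyMeasurable
  have hlint : ∫⁻ x in Ω R, ENNReal.ofReal (‖(ψ : L2 R) x‖ ^ 2 / ‖x‖ ^ 2)
      ≤ ENNReal.ofReal (A + (r ^ 2)⁻¹ * ‖(ψ : L2 R)‖ ^ 2) := by
    have i1 := (integrable_norm_sq_Lp (ψ : L2 R)).const_mul (r ^ 2)⁻¹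
    calc _ ≤ ∫⁻ x in Ω R, (ENNReal.ofReal ((χ x * ‖(ψ : L2 R) x‖) ^ 2 / ‖x‖ ^ 2)
          + ENNReal.ofReal ((r ^ 2)⁻¹ * ‖(ψ : L2 R) x‖ ^ 2)) :=
          lintegral_mono fun x =>
            (ENNReal.ofReal_le_ofReal (hpt x)).trans ENNReal.ofReal_add_le
      _ ≤ _ := by
        rw [lintegral_add_right' _ i1.1.aemeasurable.ennreal_ofReal,
          ← ofReal_integral_eq_lintegral_ofReal i1 (Eventually.of_forall fun x => by positivity),
          integral_const_mul, integral_norm_sq_Lp, ENNReal.ofReal_add hA0 (by positivity)]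
        gcongr
  have hnn : ∀ᵐ x ∂(μ R), 0 ≤ ‖(ψ : L2 R) x‖ ^ 2 / ‖x‖ ^ 2 :=
    Eventually.of_forall fun x => by positivity
  refine ⟨⟨hmeas, (hasFiniteIntegral_iff_ofReal hnn).2 (hlint.trans_lt ENNReal.ofReal_lt_top)⟩, ?_⟩
  rw [integral_eq_lintegral_of_nonneg_ae hnn hmeas]
  refine (ENNReal.toReal_le_of_le_ofReal (by positivity) hlint).trans ?_
  have := integral_gradMajorant_sq_le hε M ψ
  linarith

/-! ### The form bound for the full potential -/

theorem ae_abs_le_norm {R : ℝ} (W : Lp ℝ ∞ (μ R)) : ∀ᵐ x ∂(μ R), |W x| ≤ ‖W‖ := by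
  have h := ae_le_eLpNormEssSup (f := W) (μ := μ R)
  filter_upwards [h] with x hx
  rw [← eLpNorm_exponent_top] at hx
  rw [Lp.norm_def, ← Real.norm_eq_abs, ← toReal_enorm]
  exact ENNReal.toReal_mono (Lp.eLpNorm_ne_top W) hx

/-- The potential is form bounded with respect to the Laplacian, with bound `1 + ε`. -/
theorem potential_bound {R : ℝ} (hR : 0 < R) (W : Lp ℝ ∞ (μ R)) {ε : ℝ} (hε : 0 < ε) :
    ∃ C : ℝ, 0 < C ∧ ∀ ψ : W12 R,
      Integrable (fun x => |V W x| * ‖(ψ : L2 R) x‖ ^ 2) (μ R) ∧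
      ∫ x in Ω R, |V W x| * ‖(ψ : L2 R) x‖ ^ 2 ≤
        (1 + ε) * (∫ x in Ω R, gradSq ψ x) + C * ‖(ψ : L2 R)‖ ^ 2 := by
  obtain ⟨C, hC, h⟩ := hardy hR hε
  refine ⟨C + ‖W‖ + 1, by positivity, fun ψ => ?_⟩
  obtain ⟨h1, h2⟩ := h ψ
  have i1 := (integrable_norm_sq_Lp (ψ : L2 R)).const_mul ‖W‖
  have hpt : ∀ᵐ x ∂(μ R), |V W x| * ‖(ψ : L2 R) x‖ ^ 2
      ≤ ‖(ψ : L2 R) x‖ ^ 2 / ‖x‖ ^ 2 + ‖W‖ * ‖(ψ : L2 R) x‖ ^ 2 := by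
    filter_upwards [ae_abs_le_norm W] with x hx
    have h3 : |V W x| ≤ 1 / ‖x‖ ^ 2 + ‖W‖ := by
      refine (abs_add_le _ _).trans (add_le_add (le_of_eq ?_) hx)
      rw [abs_div, abs_neg, abs_one, abs_of_nonneg (by positivity)]
    calc |V W x| * ‖(ψ : L2 R) x‖ ^ 2 ≤ (1 / ‖x‖ ^ 2 + ‖W‖) * ‖(ψ : L2 R) x‖ ^ 2 := by gcongr
      _ = _ := by ring
  have hint : Integrable (fun x => |V W x| * ‖(ψ : L2 R) x‖ ^ 2) (μ R) := by
    refine (h1.add i1).mono'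
      ((aestronglyMeasurable_V W).norm.mul ((Lp.aestronglyMeasurable (ψ : L2 R)).norm.pow 2)) ?_
    filter_upwards [hpt] with x hx
    rw [Real.norm_of_nonneg (by positivity)]
    exact hx
  refine ⟨hint, (integral_mono_ae hint (h1.add i1) hpt).trans ?_⟩
  have e := integral_add h1 i1
  simp only [Pi.add_apply] at e ⊢
  rw [e, integral_const_mul, integral_norm_sq_Lp]
  nlinarith [sq_nonneg ‖(ψ : L2 R)‖]

end Slab

/-! ### The trace inequality -/

theorem eLpNorm_two_eq {α : Type*} [MeasurableSpace α] {ν : Measure α} (f : α → ℂ) :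
    eLpNorm f 2 ν = (∫⁻ x, ‖f x‖ₑ ^ 2 ∂ν) ^ (1 / 2 : ℝ) := by
  rw [eLpNorm_eq_lintegral_rpow_enorm_toReal two_ne_zero ENNReal.ofNat_ne_top]
  simp only [ENNReal.toReal_ofNat, ENNReal.rpow_two]

/-- The boundary value of a `C¹` function on `[-a, a]` as an integral over the interval. -/
theorem boundary_value_eq_integral {u u' : ℝ → ℂ} {a c : ℝ} (ha : 0 < a) (hc : c = a ∨ c = -a)
    (hu : ∀ s, HasDerivAt u (u' s) s) (hu' : Continuous u') :
    u c = ∫ s in (-a)..a, ((2 * a)⁻¹ • u s + ((s + c) / (2 * a)) • u' s) := by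
  have hcont : Continuous u := continuous_iff_continuousAt.2 fun s => (hu s).continuousAt
  -- The weight `(s + c)/(2a)` vanishes at the endpoint `-c`. At `s = c` it is `1` for `c = a` and
  -- `-1` for `c = -a`, the sign being absorbed by the orientation of the interval.
  rw [intervalIntegral.integral_eq_sub_of_hasDerivAt
    (f := fun s : ℝ => ((s + c) / (2 * a)) • u s) (fun s _ => ?_)
    (Continuous.intervalIntegrable (by fun_prop) _ _)]
  · rcases hc with rfl | rfl
    · have : (c + c) / (2 * c) = 1 := by field_simp; ring
      simp [this]
    · have : (-a + -a) / (2 * a) = -1 := by field_simp; ring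
      simp [this]
  · have h1 : HasDerivAt (fun s : ℝ => (s + c) / (2 * a)) (2 * a)⁻¹ s := by
      simpa using ((hasDerivAt_id s).add_const c).div_const (2 * a)
    exact (h1.fun_smul (hu s)).congr_deriv (add_comm _ _)

/-- Cauchy–Schwarz over an interval of length `2a`, with coefficients of `u` and `u'` bounded by
`(2a)⁻¹` and `1`. -/
theorem enorm_boundary_value_sq_le {u u' : ℝ → ℂ} {a c : ℝ} (ha : 0 < a) (hc : c = a ∨ c = -a)
    (hu : ∀ s, HasDerivAt u (u' s) s) (hu' : Continuous u') :
    ‖u c‖ₑ ^ 2 ≤ ENNReal.ofReal (2 * a) * (2 * ENNReal.ofReal ((2 * a)⁻¹ + 1) ^ 2) *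
      ∫⁻ s in Set.Ioc (-a) a, (‖u s‖ₑ ^ 2 + ‖u' s‖ₑ ^ 2) := by
  have hcont : Continuous u := continuous_iff_continuousAt.2 fun s => (hu s).continuousAt
  set ν : Measure ℝ := volume.restrict (Set.Ioc (-a) a) with hν
  set B := ENNReal.ofReal ((2 * a)⁻¹ + 1)
  let F : ℝ → ℂ := fun s => (2 * a)⁻¹ • u s + ((s + c) / (2 * a)) • u' s
  have hF : Continuous F := by fun_prop
  have h1 : ∀ s ∈ Set.Ioc (-a) a, ‖F s‖ₑ ^ 2 ≤ 2 * B ^ 2 * (‖u s‖ₑ ^ 2 + ‖u' s‖ₑ ^ 2) := by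
    intro s hs
    have h2 : |(s + c) / (2 * a)| ≤ 1 := by
      rw [abs_div, abs_of_pos (by positivity : 0 < 2 * a), div_le_one (by positivity), abs_le]
      rcases hc with rfl | rfl <;> constructor <;> linarith [hs.1, hs.2]
    have h3 : ‖F s‖ ^ 2 ≤ 2 * ((2 * a)⁻¹ + 1) ^ 2 * (‖u s‖ ^ 2 + ‖u' s‖ ^ 2) := by
      have h4 : ‖F s‖ ≤ ((2 * a)⁻¹ + 1) * (‖u s‖ + ‖u' s‖) := by
        refine (norm_add_le _ _).trans ?_
        rw [norm_smul, norm_smul, Real.norm_eq_abs, Real.norm_eq_abs,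
          abs_of_pos (by positivity : 0 < (2 * a)⁻¹)]
        have h5 : |(s + c) / (2 * a)| * ‖u' s‖ ≤ 1 * ‖u' s‖ := by gcongr
        have h6 : 0 ≤ (2 * a)⁻¹ * ‖u' s‖ := by positivity
        nlinarith [norm_nonneg (u s)]
      calc ‖F s‖ ^ 2 ≤ (((2 * a)⁻¹ + 1) * (‖u s‖ + ‖u' s‖)) ^ 2 := by gcongr
        _ = ((2 * a)⁻¹ + 1) ^ 2 * (‖u s‖ + ‖u' s‖) ^ 2 := by ring
        _ ≤ ((2 * a)⁻¹ + 1) ^ 2 * (2 * (‖u s‖ ^ 2 + ‖u' s‖ ^ 2)) := by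
          gcongr
          exact add_sq_le
        _ = _ := by ring
    have h4 := ENNReal.ofReal_le_ofReal h3
    rw [ENNReal.ofReal_mul (by positivity), ENNReal.ofReal_mul (by positivity),
      ENNReal.ofReal_add (by positivity) (by positivity), ENNReal.ofReal_pow (by positivity),
      ENNReal.ofReal_pow (by positivity), ENNReal.ofReal_pow (by positivity),
      ENNReal.ofReal_pow (by positivity), ofReal_norm, ofReal_norm, ofReal_norm,
      ENNReal.ofReal_ofNat] at h4
    exact h4
  have h2 : u c = ∫ s, F s ∂ν := by
    rw [boundary_value_eq_integral ha hc hu hu', intervalIntegral.integral_of_le (by linarith)]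
  calc ‖u c‖ₑ ^ 2 ≤ (∫⁻ s, 1 * ‖F s‖ₑ ∂ν) ^ 2 := by
        rw [h2]
        gcongr
        simpa only [one_mul] using enorm_integral_le_lintegral_enorm F
    _ ≤ (∫⁻ _, 1 ^ 2 ∂ν) * ∫⁻ s, ‖F s‖ₑ ^ 2 ∂ν :=
        lintegral_mul_sq_le aemeasurable_const hF.measurable.enorm.aemeasurable
    _ ≤ ENNReal.ofReal (2 * a) * ∫⁻ s, 2 * B ^ 2 * (‖u s‖ₑ ^ 2 + ‖u' s‖ₑ ^ 2) ∂ν := by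
        refine mul_le_mul' (le_of_eq ?_) (setLIntegral_mono' measurableSet_Ioc h1)
        simp [hν, two_mul]
    _ = _ := by
        rw [lintegral_const_mul' _ _ (by finiteness)]
        ring

namespace Slab

/-- This is Fubini for the slab: `face` inserts the fourth coordinate, which has index `3`. -/
theorem measurePreserving_face :
    MeasurePreserving (fun p : ℝ × EuclideanSpace ℝ (Fin 3) => face p.1 p.2)
      (volume.prod volume) volume := by
  have h1 := (MeasurePreserving.id (volume : Measure ℝ)).prod
    (PiLp.volume_preserving_ofLp (Fin 3))
  have h2 := (volume_preserving_piFinSuccAbove (fun _ : Fin 4 => ℝ) 3).symm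
  have h3 := (PiLp.volume_preserving_toLp (Fin 4)).comp (h2.comp h1)
  have e : (fun p : ℝ × EuclideanSpace ℝ (Fin 3) => face p.1 p.2) = WithLp.toLp 2 ∘
      (MeasurableEquiv.piFinSuccAbove (fun _ : Fin 4 => ℝ) 3).symm ∘ Prod.map id WithLp.ofLp := by
    funext p
    ext i
    fin_cases i <;> rfl
  rw [e]
  exact h3

theorem measurable_face_uncurry :
    Measurable fun p : ℝ × EuclideanSpace ℝ (Fin 3) => face p.1 p.2 :=
  measurePreserving_face.measurable

theorem lintegral_slab_eq {R : ℝ} {g : EuclideanSpace ℝ (Fin 4) → ℝ≥0∞} (hg : Measurable g) :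
    ∫⁻ x in Ω R, g x = ∫⁻ y, ∫⁻ s in Set.Ioc (-(Real.pi * R)) (Real.pi * R), g (face s y) := by
  have h1 : Measurable fun p : ℝ × EuclideanSpace ℝ (Fin 3) => (Ω R).indicator g (face p.1 p.2) :=
    (hg.indicator (isOpen_Ω R).measurableSet).comp measurable_face_uncurry
  rw [← lintegral_indicator (isOpen_Ω R).measurableSet,
    ← measurePreserving_face.lintegral_comp (hg.indicator (isOpen_Ω R).measurableSet),
    lintegral_prod_symm _ h1.aemeasurable]
  refine lintegral_congr fun y => ?_
  rw [setLIntegral_congr Ioo_ae_eq_Ioc.symm, ← lintegral_indicator measurableSet_Ioo]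
  refine lintegral_congr fun s => ?_
  rfl

theorem hasDerivAt_comp_face {φ : EuclideanSpace ℝ (Fin 4) → ℂ} (hφ : ContDiff ℝ ∞ φ)
    (y : EuclideanSpace ℝ (Fin 3)) (s : ℝ) :
    HasDerivAt (fun s => φ (face s y)) (pderiv 3 φ (face s y)) s := by
  have h1 : (fun s => face s y) = fun s : ℝ => face 0 y + s • EuclideanSpace.single 3 1 := by
    ext s i
    fin_cases i <;> simp [face]
  have h2 : HasDerivAt (fun s => face s y) (EuclideanSpace.single 3 1) s := by
    rw [h1]
    simpa using ((hasDerivAt_id s).smul_const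
      (EuclideanSpace.single (3 : Fin 4) (1 : ℝ))).const_add (face 0 y)
  exact (hφ.differentiable (by simp) (face s y)).hasFDerivAt.comp_hasDerivAt s h2

theorem continuous_face_left (y : EuclideanSpace ℝ (Fin 3)) : Continuous fun s => face s y := by
  unfold face
  refine (PiLp.continuous_toLp 2 _).comp (continuous_pi fun i => ?_)
  fin_cases i <;> simp <;> fun_prop

/-- The trace inequality for smooth functions. -/
theorem exists_trace_bound {R : ℝ} (hR : 0 < R) : ∃ K : ℝ≥0∞, K ≠ ⊤ ∧ ∀ c : ℝ,
    c = Real.pi * R ∨ c = -(Real.pi * R) → ∀ φ : EuclideanSpace ℝ (Fin 4) → ℂ, ContDiff ℝ ∞ φ →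
    eLpNorm (fun y => φ (face c y)) 2 volume
      ≤ K * (eLpNorm φ 2 (μ R) + eLpNorm (pderiv 3 φ) 2 (μ R)) := by
  have ha : 0 < Real.pi * R := by positivity
  set a := Real.pi * R with hadef
  set K₀ := ENNReal.ofReal (2 * a) * (2 * ENNReal.ofReal ((2 * a)⁻¹ + 1) ^ 2) with hK₀
  have hK₀t : K₀ ≠ ⊤ := by finiteness
  refine ⟨K₀ ^ (1 / 2 : ℝ), by finiteness, fun c hc φ hφ => ?_⟩
  have m1 : Measurable fun x => ‖φ x‖ₑ ^ 2 := hφ.continuous.measurable.enorm.pow_const 2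
  have m2 : Measurable fun x => ‖pderiv 3 φ x‖ₑ ^ 2 :=
    (continuous_pderiv' hφ 3).measurable.enorm.pow_const 2
  have h1 : ∫⁻ y, ‖φ (face c y)‖ₑ ^ 2
      ≤ K₀ * ((∫⁻ x in Ω R, ‖φ x‖ₑ ^ 2) + ∫⁻ x in Ω R, ‖pderiv 3 φ x‖ₑ ^ 2) := by
    rw [← lintegral_add_left m1, lintegral_slab_eq (g := fun x => ‖φ x‖ₑ ^ 2 + ‖pderiv 3 φ x‖ₑ ^ 2) (m1.add m2), ← lintegral_const_mul' _ _ hK₀t]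
    refine lintegral_mono fun y => ?_
    exact enorm_boundary_value_sq_le ha hc (fun s => hasDerivAt_comp_face hφ y s)
      ((continuous_pderiv' hφ 3).comp (continuous_face_left y))
  rw [eLpNorm_two_eq, eLpNorm_two_eq, eLpNorm_two_eq]
  calc _ ≤ (K₀ * ((∫⁻ x in Ω R, ‖φ x‖ₑ ^ 2) + ∫⁻ x in Ω R, ‖pderiv 3 φ x‖ₑ ^ 2)) ^ (1 / 2 : ℝ) := by
        gcongr
    _ ≤ _ := by
        rw [ENNReal.mul_rpow_of_nonneg _ _ (by norm_num)]
        gcongr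
        exact ENNReal.rpow_add_le_add_rpow _ _ (by norm_num) (by norm_num)

/-- The trace inequality on `W^{1,2}(Ω)`. -/
theorem exists_hasTrace_bound {R : ℝ} (hR : 0 < R) : ∃ K : ℝ≥0∞, K ≠ ⊤ ∧ ∀ c : ℝ,
    c = Real.pi * R ∨ c = -(Real.pi * R) → ∀ (ψ : W12 R) f, HasTrace c ψ f →
    ‖f‖ₑ ≤ K * (‖(ψ : L2 R)‖ₑ + ‖weakPartial R 3 ψ‖ₑ) := by
  obtain ⟨K, hK, h⟩ := exists_trace_bound hR
  refine ⟨K, hK, fun c hc ψ f ⟨φ, hs, h1, h2, h3⟩ => ?_⟩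
  have hle : ∀ n, ‖f‖ₑ ≤ eLpNorm (fun y => φ n (face c y) - f y) 2 volume
      + K * ((eLpNorm (fun x => φ n x - (ψ : L2 R) x) 2 (μ R) + ‖(ψ : L2 R)‖ₑ)
        + (eLpNorm (fun x => pderiv 3 (φ n) x - weakPartial R 3 ψ x) 2 (μ R)
          + ‖weakPartial R 3 ψ‖ₑ)) := by
    intro n
    have tri : ∀ {α : Type} [MeasurableSpace α] {ν : Measure α} {p : α → ℂ} (q : Lp ℂ 2 ν),
        AEStronglyMeasurable p ν →
        eLpNorm p 2 ν ≤ eLpNorm (fun x => p x - q x) 2 ν + ‖q‖ₑ ∧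
        ‖q‖ₑ ≤ eLpNorm (fun x => p x - q x) 2 ν + eLpNorm p 2 ν := by
      intro α _ ν p q hp
      have hq := Lp.aestronglyMeasurable q
      constructor
      · have := eLpNorm_add_le (hp.sub hq) hq (p := 2) (by norm_num)
        rw [sub_add_cancel] at this
        rw [Lp.enorm_def]
        exact this
      · have := eLpNorm_sub_le hp (hp.sub hq) (p := 2) (by norm_num)
        rw [sub_sub_cancel, add_comm] at this
        rw [Lp.enorm_def, add_comm]
        rw [add_comm] at this
        exact this
    have c1 := (hs n).1.continuous
    refine (tri (p := fun y => φ n (face c y)) f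
      (c1.comp (continuous_face c)).aestronglyMeasurable).2.trans ?_
    gcongr
    refine (h c hc (φ n) (hs n).1).trans ?_
    gcongr
    · exact (tri (ψ : L2 R) c1.aestronglyMeasurable).1
    · exact (tri (weakPartial R 3 ψ) (continuous_pderiv' (hs n).1 3).aestronglyMeasurable).1
  have hlim := h3.add (ENNReal.Tendsto.const_mul (a := K)
    ((h1.add_const ‖(ψ : L2 R)‖ₑ).add ((h2 3).add_const ‖weakPartial R 3 ψ‖ₑ)) (Or.inr hK))
  simp only [zero_add] at hlim
  exact ge_of_tendsto' hlim hle

/-! ### Passage to the limit in the boundary condition -/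

/-- Traces are stable under simultaneous limits. -/
theorem HasTrace.of_tendsto {R c : ℝ} {u : ℕ → W12 R} {ψ : W12 R}
    {f : ℕ → Lp ℂ 2 (volume : Measure (EuclideanSpace ℝ (Fin 3)))} {g : Lp ℂ 2 volume}
    (hf : ∀ n, HasTrace c (u n) (f n))
    (h0 : Tendsto (fun n => ((u n : W12 R) : L2 R)) atTop (𝓝 ψ))
    (h1 : ∀ i, Tendsto (fun n => weakPartial R i (u n)) atTop (𝓝 (weakPartial R i ψ)))
    (hg : Tendsto f atTop (𝓝 g)) : HasTrace c ψ g := by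
  -- Diagonal choice: one smooth function within `1/n` of `u n`, of its gradient and of its trace at
  -- once. At `n = 0` the tolerance is `⊤`.
  have hex : ∀ n : ℕ, ∃ φ : EuclideanSpace ℝ (Fin 4) → ℂ,
      (ContDiff ℝ ∞ φ ∧ HasCompactSupport φ) ∧
      eLpNorm (fun x => φ x - ((u n : W12 R) : L2 R) x) 2 (μ R) < (n : ℝ≥0∞)⁻¹ ∧
      (∀ i, eLpNorm (fun x => pderiv i φ x - weakPartial R i (u n) x) 2 (μ R) < (n : ℝ≥0∞)⁻¹) ∧
      eLpNorm (fun y => φ (face c y) - f n y) 2 volume < (n : ℝ≥0∞)⁻¹ := by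
    intro n
    obtain ⟨φ, hs, e1, e2, e3⟩ := hf n
    have hpos : (0 : ℝ≥0∞) < (n : ℝ≥0∞)⁻¹ := by simp
    obtain ⟨k, k1, k2, k3⟩ := ((e1.eventually_lt_const hpos).and
      ((eventually_all.2 fun i => (e2 i).eventually_lt_const hpos).and
        (e3.eventually_lt_const hpos))).exists
    exact ⟨φ k, hs k, k1, k2, k3⟩
  choose φ hs e1 e2 e3 using hex
  have lim : ∀ {α : Type} [MeasurableSpace α] {ν : Measure α} {p : ℕ → α → ℂ} {q : ℕ → Lp ℂ 2 ν}
      {r : Lp ℂ 2 ν}, (∀ n, AEStronglyMeasurable (p n) ν) →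
      (∀ n : ℕ, eLpNorm (fun x => p n x - q n x) 2 ν < (n : ℝ≥0∞)⁻¹) →
      Tendsto q atTop (𝓝 r) →
      Tendsto (fun n => eLpNorm (fun x => p n x - r x) 2 ν) atTop (𝓝 0) := by
    intro α _ ν p q r hp hpq hq
    have hq' : Tendsto (fun n => eLpNorm (fun x => q n x - r x) 2 ν) atTop (𝓝 0) := by
      have := (Lp.tendsto_Lp_iff_tendsto_eLpNorm' q r).1 hq
      exact this
    have hsum := ENNReal.tendsto_inv_nat_nhds_zero.add hq'
    rw [add_zero] at hsum
    refine tendsto_of_tendsto_of_tendsto_of_le_of_le tendsto_const_nhds hsum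
      (fun _ => zero_le) fun n => ?_
    have := eLpNorm_add_le ((hp n).sub (Lp.aestronglyMeasurable (q n)))
      ((Lp.aestronglyMeasurable (q n)).sub (Lp.aestronglyMeasurable r)) (p := 2) (by norm_num)
    rw [sub_add_sub_cancel] at this
    exact this.trans (add_le_add (hpq n).le le_rfl)
  refine ⟨φ, hs, lim (fun n => (hs n).1.continuous.aestronglyMeasurable) e1 h0, fun i =>
    lim (fun n => (continuous_pderiv' (hs n).1 i).aestronglyMeasurable) (fun n => e2 n i) (h1 i),
    lim (fun n => ((hs n).1.continuous.comp (continuous_face c)).aestronglyMeasurable) e3 hg⟩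

/-- Periodicity is stable under limits in `W^{1,2}(Ω)`. -/
theorem periodic_of_tendsto {R : ℝ} (hR : 0 < R) {u : ℕ → W12 R} {ψ : W12 R}
    (hu : ∀ n, u n ∈ periodic R)
    (h0 : Tendsto (fun n => ((u n : W12 R) : L2 R)) atTop (𝓝 ψ))
    (h1 : ∀ i, Tendsto (fun n => weakPartial R i (u n)) atTop (𝓝 (weakPartial R i ψ))) :
    ψ ∈ periodic R := by
  choose f hf using hu
  obtain ⟨K, hK, hb⟩ := exists_hasTrace_bound hR
  have hdiff : ∀ n m, ‖f n - f m‖ₑ ≤ K * (‖((u n : W12 R) : L2 R) - (u m : W12 R)‖ₑ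
      + ‖weakPartial R 3 (u n) - weakPartial R 3 (u m)‖ₑ) := by
    intro n m
    -- One face suffices for convergence, since periodicity means that the same `f n` is the trace
    -- on both faces.
    have h2 := hb (Real.pi * R) (Or.inl rfl) _ _ ((hf n).2.add ((hf m).2.smul (-1)))
    rw [neg_one_smul, neg_one_smul, ← sub_eq_add_neg, ← sub_eq_add_neg, map_sub] at h2
    exact h2
  have hc : CauchySeq f := by
    rw [EMetric.cauchySeq_iff]
    intro ε hε
    have hlim : Tendsto (fun p : ℕ × ℕ => K * (‖((u p.1 : W12 R) : L2 R) - (u p.2 : W12 R)‖ₑ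
        + ‖weakPartial R 3 (u p.1) - weakPartial R 3 (u p.2)‖ₑ)) atTop (𝓝 0) := by
      rw [← prod_atTop_atTop_eq]
      have t1 := ((h0.comp tendsto_fst).sub (h0.comp tendsto_snd)).enorm
      have t2 := (((h1 3).comp tendsto_fst).sub ((h1 3).comp tendsto_snd)).enorm
      have t3 := ENNReal.Tendsto.const_mul (a := K) (t1.add t2) (Or.inr hK)
      simpa using t3
    obtain ⟨N, hN⟩ := eventually_atTop.1 (hlim.eventually_lt_const hε)
    refine ⟨max N.1 N.2, fun m hm n hn => ?_⟩
    rw [edist_eq_enorm_sub]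
    exact (hdiff m n).trans_lt (hN (m, n)
      ⟨(le_max_left _ _).trans hm, (le_max_right _ _).trans hn⟩)
  obtain ⟨g, hg⟩ := cauchySeq_tendsto_of_complete hc
  exact ⟨g, HasTrace.of_tendsto (fun n => (hf n).1) h0 h1 hg,
    HasTrace.of_tendsto (fun n => (hf n).2) h0 h1 hg⟩

end Slab

namespace Slab

/-! ### Closedness of the weak derivative and density of test functions -/

/-- For a fixed test function both sides of the defining identity are continuous functionals on
`L²`, being inner products with it or its derivative. -/
theorem HasWeakPartial.of_tendsto {R : ℝ} {i : Fin 4} {u g : ℕ → L2 R} {ψ η : L2 R}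
    (h : ∀ n, HasWeakPartial R i (u n) (g n)) (hu : Tendsto u atTop (𝓝 ψ))
    (hg : Tendsto g atTop (𝓝 η)) : HasWeakPartial R i ψ η := by
  have key : ∀ {p : EuclideanSpace ℝ (Fin 4) → ℝ}, Continuous p → HasCompactSupport p →
      Continuous fun w : L2 R => ∫ x in Ω R, p x • w x := by
    intro p hp hpc
    have hpM : MemLp (fun x => (p x : ℂ)) 2 (μ R) :=
      ((Complex.continuous_ofReal.comp hp).memLp_of_hasCompactSupport
        (hpc.comp_left Complex.ofReal_zero)).restrict _
    have e : (fun w : L2 R => ∫ x in Ω R, p x • w x) = fun w => inner ℂ hpM.toLp w := by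
      funext w
      rw [L2.inner_def]
      refine integral_congr_ae ?_
      filter_upwards [hpM.coeFn_toLp] with x hx
      rw [hx, RCLike.inner_apply, Complex.conj_ofReal, Complex.real_smul, mul_comm]
    rw [e]
    fun_prop
  intro φ hφ hc hs
  have l1 := ((key (continuous_pderiv hφ i) (hasCompactSupport_pderiv hc i)).tendsto ψ).comp hu
  have l2 := ((key hφ.continuous hc).tendsto η).comp hg
  exact tendsto_nhds_unique l1 (l2.neg.congr fun n => (h n φ hφ hc hs).symm)

theorem mem_W12per_iff {R : ℝ} {ψ : L2 R} :
    ψ ∈ W12per R ↔ ∃ h : ψ ∈ W12 R, (⟨ψ, h⟩ : W12 R) ∈ periodic R := by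
  simp [W12per]

theorem memLp_test {R : ℝ} {φ : EuclideanSpace ℝ (Fin 4) → ℂ} (hφ : Continuous φ)
    (hc : HasCompactSupport φ) : MemLp φ 2 (μ R) :=
  (hφ.memLp_of_hasCompactSupport hc).restrict _

theorem hasWeakPartial_test {R : ℝ} {φ : EuclideanSpace ℝ (Fin 4) → ℂ} (hφ : ContDiff ℝ ∞ φ)
    (hc : HasCompactSupport φ) (i : Fin 4) :
    HasWeakPartial R i (memLp_test hφ.continuous hc).toLp
      (memLp_test (continuous_pderiv' hφ i) (hc.fderiv_apply ℝ _)).toLp := by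
  intro χ hχ hχc hχs
  have hd := continuous_pderiv' hφ i
  have hdχ := continuous_pderiv hχ i
  have e : ∀ {p : EuclideanSpace ℝ (Fin 4) → ℝ} {q : EuclideanSpace ℝ (Fin 4) → ℂ}
      (hq : MemLp q 2 (μ R)), tsupport p ⊆ Ω R →
      ∫ x in Ω R, p x • hq.toLp q x = ∫ x, p x • q x := by
    intro p q hq hp
    have e1 : ∫ x in Ω R, p x • hq.toLp q x = ∫ x in Ω R, p x • q x := by
      refine integral_congr_ae ?_
      filter_upwards [hq.coeFn_toLp] with x hx
      rw [hx]
    rw [e1]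
    refine setIntegral_eq_integral_of_forall_compl_eq_zero fun x hx => ?_
    rw [image_eq_zero_of_notMem_tsupport (fun hx' => hx (hp hx')), zero_smul]
  have hs' : tsupport (pderiv i χ) ⊆ Ω R := (tsupport_fderiv_apply_subset ℝ _).trans hχs
  rw [e _ hs', e _ hχs]
  have c1 := hχ.continuous
  have c2 := hφ.continuous
  have hχ' := hasCompactSupport_pderiv hχc i
  have := integral_smul_fderiv_eq_neg_fderiv_smul_of_integrable
    (μ := (volume : Measure (EuclideanSpace ℝ (Fin 4)))) (f := χ) (g := φ)
    (v := EuclideanSpace.single i 1)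
    ((hdχ.smul c2).integrable_of_hasCompactSupport hχ'.smul_right)
    ((c1.smul hd).integrable_of_hasCompactSupport hχc.smul_right)
    ((c1.smul c2).integrable_of_hasCompactSupport hχc.smul_right)
    (fun x _ => hχ.differentiable (by simp) x) (fun x _ => hφ.differentiable (by simp) x)
  unfold pderiv
  rw [this, neg_neg]

/-- The constant sequence `φ` witnesses trace zero on both faces, as the faces are disjoint from the
open slab containing its support. -/
theorem test_mem_W12per {R : ℝ} {φ : EuclideanSpace ℝ (Fin 4) → ℂ} (hφ : ContDiff ℝ ∞ φ)
    (hc : HasCompactSupport φ) (hs : tsupport φ ⊆ Ω R) :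
    (memLp_test hφ.continuous hc).toLp ∈ W12per R := by
  have hw : (memLp_test hφ.continuous hc).toLp ∈ W12 R := fun i => ⟨_, hasWeakPartial_test hφ hc i⟩
  have hz : ∀ {ν : Measure (EuclideanSpace ℝ (Fin 4))}
      {p : EuclideanSpace ℝ (Fin 4) → ℂ} (hp : MemLp p 2 ν),
      eLpNorm (fun x => p x - hp.toLp p x) 2 ν = 0 := by
    intro ν p hp
    rw [← eLpNorm_zero (ε := ℂ) (p := 2) (μ := ν)]
    refine eLpNorm_congr_ae ?_
    filter_upwards [hp.coeFn_toLp] with x hx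
    simp [hx]
  have htr : ∀ c, (∀ y, face c y ∉ Ω R) → HasTrace c (⟨_, hw⟩ : W12 R) 0 := by
    intro c hc'
    refine ⟨fun _ => φ, fun _ => ⟨hφ, hc⟩, ?_, fun i => ?_, ?_⟩
    · exact tendsto_const_nhds.congr fun _ => (hz (memLp_test hφ.continuous hc)).symm
    · rw [(weakPartial_spec R i ⟨_, hw⟩).unique (hasWeakPartial_test hφ hc i)]
      exact tendsto_const_nhds.congr fun _ => (hz _).symm
    · refine tendsto_const_nhds.congr fun _ => ?_
      rw [← eLpNorm_zero (ε := ℂ) (p := 2) (μ := (volume : Measure (EuclideanSpace ℝ (Fin 3))))]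
      refine eLpNorm_congr_ae ?_
      filter_upwards [Lp.coeFn_zero ℂ 2 (volume : Measure (EuclideanSpace ℝ (Fin 3)))] with y hy
      rw [hy, image_eq_zero_of_notMem_tsupport fun h => hc' y (hs h)]
      simp
  refine mem_W12per_iff.2 ⟨hw, 0, htr _ fun y hy => ?_, htr _ fun y hy => ?_⟩
  · exact lt_irrefl _ hy.1
  · exact lt_irrefl _ hy.2

/-- Anything orthogonal to the space is orthogonal to all test functions in the slab, hence zero by
the fundamental lemma of the calculus of variations. -/
theorem dense_W12per (R : ℝ) : Dense (W12per R : Set (L2 R)) := by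
  rw [Submodule.dense_iff_topologicalClosure_eq_top, Submodule.topologicalClosure_eq_top_iff,
    Submodule.eq_bot_iff]
  intro w hw
  have key : ∀ᵐ x ∂(volume : Measure (EuclideanSpace ℝ (Fin 4))), x ∈ Ω R → w x = 0 := by
    refine (isOpen_Ω R).ae_eq_zero_of_integral_contDiff_smul_eq_zero ?_ ?_
    · exact locallyIntegrableOn_of_locallyIntegrable_restrict
        ((Lp.memLp w).locallyIntegrable (by norm_num))
    · intro φ hφ hc hs
      have hφ' : ContDiff ℝ ∞ fun x => (φ x : ℂ) := Complex.ofRealCLM.contDiff.comp hφ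
      have hc' : HasCompactSupport fun x => (φ x : ℂ) := hc.comp_left Complex.ofReal_zero
      have hs' : tsupport (fun x => (φ x : ℂ)) ⊆ Ω R :=
        (tsupport_comp_subset Complex.ofReal_zero φ).trans hs
      have h1 : inner ℂ (memLp_test (R := R) hφ'.continuous hc').toLp w = 0 :=
        (Submodule.mem_orthogonal _ _).1 hw _ (test_mem_W12per hφ' hc' hs')
      have h2 : ∫ x in Ω R, φ x • w x = 0 := by
        rw [← h1, L2.inner_def]
        refine integral_congr_ae ?_
        filter_upwards [(memLp_test (R := R) hφ'.continuous hc').coeFn_toLp] with x hx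
        rw [hx, RCLike.inner_apply, Complex.conj_ofReal, Complex.real_smul, mul_comm]
      rw [← h2]
      refine (setIntegral_eq_integral_of_forall_compl_eq_zero fun x hx => ?_).symm
      rw [image_eq_zero_of_notMem_tsupport (fun hx' => hx (hs hx')), zero_smul]
  refine (Lp.eq_zero_iff_ae_eq_zero).2 ?_
  exact (ae_restrict_iff' (isOpen_Ω R).measurableSet).2 key

/-! ### The form sum -/

theorem W12_le_potentialDom {R : ℝ} (hR : 0 < R) (W : Lp ℝ ∞ (μ R)) : W12 R ≤ potentialDom W := by
  intro ψ hψ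
  obtain ⟨C, -, h⟩ := potential_bound hR W one_pos
  refine (h ⟨ψ, hψ⟩).1.mono'
    ((aestronglyMeasurable_V W).mul ((Lp.aestronglyMeasurable ψ).norm.pow 2))
    (Eventually.of_forall fun x => ?_)
  rw [norm_mul, norm_pow, norm_norm, Real.norm_eq_abs]

theorem formSum_dom {R : ℝ} (hR : 0 < R) (Z : ℝ) (W : Lp ℝ ∞ (μ R)) :
    (formSum Z W).dom = W12per R :=
  inf_eq_left.2 ((W12per_le R).trans (W12_le_potentialDom hR W))

/-- The inclusion of the domain of the form sum in `W^{1,2}(Ω)`. -/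
noncomputable def toW12 {R : ℝ} (Z : ℝ) (W : Lp ℝ ∞ (μ R)) : (formSum Z W).dom →ₗ[ℂ] W12 R :=
  Submodule.inclusion (inf_le_left.trans (W12per_le R))

theorem formSum_apply {R : ℝ} (Z : ℝ) (W : Lp ℝ ∞ (μ R)) (φ ψ : (formSum Z W).dom) :
    (formSum Z W).form φ ψ
      = ∑ i, inner ℂ (weakPartial R i (toW12 Z W φ)) (weakPartial R i (toW12 Z W ψ))
        + Z * ∫ x in Ω R, (V W x : ℂ) * (starRingEnd ℂ ((φ : L2 R) x) * (ψ : L2 R) x) :=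
  rfl

theorem formSum_isSymm {R : ℝ} (Z : ℝ) (W : Lp ℝ ∞ (μ R)) : (formSum Z W).IsSymm := by
  intro φ ψ
  rw [formSum_apply, formSum_apply, map_add, map_sum, map_mul, Complex.conj_ofReal,
    ← integral_conj]
  congr 1
  · exact Finset.sum_congr rfl fun i _ => (inner_conj_symm _ _).symm
  · congr 2
    funext x
    rw [map_mul, map_mul, Complex.conj_ofReal, Complex.conj_conj]
    ring

theorem integral_gradSq {R : ℝ} (ψ : W12 R) :
    ∫ x in Ω R, gradSq ψ x = ∑ i, ‖weakPartial R i ψ‖ ^ 2 := by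
  unfold gradSq
  rw [integral_finsetSum _ fun i _ => integrable_norm_sq_Lp _]
  exact Finset.sum_congr rfl fun i _ => integral_norm_sq_Lp _

theorem formSum_self {R : ℝ} (Z : ℝ) (W : Lp ℝ ∞ (μ R)) (ψ : (formSum Z W).dom) :
    (formSum Z W).form ψ ψ = ((∑ i, ‖weakPartial R i (toW12 Z W ψ)‖ ^ 2
      + Z * ∫ x in Ω R, V W x * ‖(ψ : L2 R) x‖ ^ 2 : ℝ) : ℂ) := by
  rw [formSum_apply]
  push_cast
  rw [← integral_complex_ofReal]
  congr 1
  · refine Finset.sum_congr rfl fun i _ => ?_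
    rw [inner_self_eq_norm_sq_to_K]
    rfl
  · congr 2
    funext x
    rw [mul_comm (starRingEnd ℂ _), Complex.mul_conj, Complex.normSq_eq_norm_sq]
    push_cast
    ring

/-- For `0 ≤ Z < 1` the form sum is comparable to the kinetic form. -/
theorem formSum_bounds {R : ℝ} (hR : 0 < R) {Z : ℝ} (hZ : 0 ≤ Z) (hZ1 : Z < 1)
    (W : Lp ℝ ∞ (μ R)) : ∃ κ C : ℝ, 0 < κ ∧ ∀ ψ : (formSum Z W).dom,
      κ * ∑ i, ‖weakPartial R i (toW12 Z W ψ)‖ ^ 2 - C * ‖(ψ : L2 R)‖ ^ 2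
        ≤ ((formSum Z W).form ψ ψ).re ∧
      ‖(formSum Z W).form ψ ψ‖
        ≤ 2 * ∑ i, ‖weakPartial R i (toW12 Z W ψ)‖ ^ 2 + C * ‖(ψ : L2 R)‖ ^ 2 := by
  obtain ⟨C, hC, h⟩ := potential_bound hR W (ε := (1 - Z) / 2) (by linarith)
  -- With `ε = (1 - Z)/2` this `κ` equals `(1 - Z)(2 - Z)/2`, positive exactly because `Z < 1` in
  -- the given range.
  refine ⟨1 - Z * (1 + (1 - Z) / 2), Z * C, by nlinarith, fun ψ => ?_⟩
  obtain ⟨h1, h2⟩ := h (toW12 Z W ψ)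
  rw [integral_gradSq] at h2
  have h3 : |∫ x in Ω R, V W x * ‖(ψ : L2 R) x‖ ^ 2|
      ≤ ∫ x in Ω R, |V W x| * ‖(ψ : L2 R) x‖ ^ 2 := by
    refine abs_integral_le_integral_abs.trans (le_of_eq ?_)
    congr 1
    funext x
    rw [abs_mul, abs_pow, abs_norm]
  rw [formSum_self, Complex.ofReal_re, Complex.norm_real, Real.norm_eq_abs]
  set G := ∑ i, ‖weakPartial R i (toW12 Z W ψ)‖ ^ 2
  set I := ∫ x in Ω R, V W x * ‖(ψ : L2 R) x‖ ^ 2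
  have hG : 0 ≤ G := Finset.sum_nonneg fun _ _ => sq_nonneg _
  have h4 : Z * |I| ≤ Z * ((1 + (1 - Z) / 2) * G + C * ‖(ψ : L2 R)‖ ^ 2) :=
    mul_le_mul_of_nonneg_left (h3.trans h2) hZ
  have h5 : Z * (1 + (1 - Z) / 2) ≤ 1 := by nlinarith
  have h6 : Z * (1 + (1 - Z) / 2) * G ≤ 1 * G := mul_le_mul_of_nonneg_right h5 hG
  have h7 : |Z * I| = Z * |I| := by rw [abs_mul, abs_of_nonneg hZ]
  constructor
  · have := neg_abs_le (Z * I)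
    linarith
  · refine (abs_add_le _ _).trans ?_
    rw [abs_of_nonneg hG, h7]
    linarith

theorem formSum_isBoundedBelow {R : ℝ} (hR : 0 < R) {Z : ℝ} (hZ : 0 ≤ Z) (hZ1 : Z < 1)
    (W : Lp ℝ ∞ (μ R)) : (formSum Z W).IsBoundedBelow := by
  obtain ⟨κ, C, hκ, h⟩ := formSum_bounds hR hZ hZ1 W
  refine ⟨-C, fun ψ => ?_⟩
  have h1 : 0 ≤ κ * ∑ i, ‖weakPartial R i (toW12 Z W ψ)‖ ^ 2 := by positivity
  linarith [(h ψ).1]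

/-- The lower bound of `formSum_bounds` makes the gradients Cauchy. The limits are the weak
derivatives of `ψ`, periodicity survives, and the upper bound turns gradient convergence back into
form convergence. -/
theorem formSum_isClosed {R : ℝ} (hR : 0 < R) {Z : ℝ} (hZ : 0 ≤ Z) (hZ1 : Z < 1)
    (W : Lp ℝ ∞ (μ R)) : (formSum Z W).IsClosed := by
  obtain ⟨κ, C, hκ, h⟩ := formSum_bounds hR hZ hZ1 W
  intro u ψ hu hform
  have hsub : Tendsto (fun p : ℕ × ℕ => ‖((u p.1 - u p.2 : (formSum Z W).dom) : L2 R)‖)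
      atTop (𝓝 0) := by
    have := cauchySeq_iff_tendsto_dist_atTop_0.1 hu.cauchySeq
    simp only [dist_eq_norm] at this
    exact this
  have hG : Tendsto (fun p : ℕ × ℕ => ∑ i, ‖weakPartial R i (toW12 Z W (u p.1 - u p.2))‖ ^ 2)
      atTop (𝓝 0) := by
    have l1 := ((((Complex.continuous_re.tendsto _).comp hform).add
      ((hsub.pow 2).const_mul C)).const_mul κ⁻¹)
    simp only [Complex.zero_re, ne_eq, OfNat.ofNat_ne_zero, not_false_eq_true, zero_pow, mul_zero,
      add_zero] at l1
    refine squeeze_zero (fun _ => Finset.sum_nonneg fun _ _ => sq_nonneg _) (fun p => ?_) l1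
    rw [inv_mul_eq_div, le_div_iff₀ hκ, Function.comp_apply]
    linarith [(h (u p.1 - u p.2)).1]
  have hcau : ∀ i, CauchySeq fun n => weakPartial R i (toW12 Z W (u n)) := by
    intro i
    rw [cauchySeq_iff_tendsto_dist_atTop_0]
    have l1 := (Real.continuous_sqrt.tendsto _).comp hG
    rw [Real.sqrt_zero] at l1
    refine squeeze_zero (fun _ => dist_nonneg) (fun p => ?_) l1
    rw [dist_eq_norm, ← map_sub, ← map_sub]
    refine Real.le_sqrt_of_sq_le ?_
    exact Finset.single_le_sum (f := fun j => ‖weakPartial R j (toW12 Z W (u p.1 - u p.2))‖ ^ 2)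
      (fun _ _ => sq_nonneg _) (Finset.mem_univ i)
  choose g hg using fun i => cauchySeq_tendsto_of_complete (hcau i)
  have hweak : ∀ i, HasWeakPartial R i ψ (g i) := fun i =>
    HasWeakPartial.of_tendsto (fun n => weakPartial_spec R i (toW12 Z W (u n))) hu (hg i)
  have hW : ψ ∈ W12 R := fun i => ⟨g i, hweak i⟩
  have hgi : ∀ i, weakPartial R i ⟨ψ, hW⟩ = g i := fun i =>
    (weakPartial_spec R i ⟨ψ, hW⟩).unique (hweak i)
  have hper : (⟨ψ, hW⟩ : W12 R) ∈ periodic R :=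
    periodic_of_tendsto hR (u := fun n => toW12 Z W (u n))
      (fun n => (mem_W12per_iff.1 (u n).2.1).choose_spec) hu
      (fun i => by rw [hgi]; exact hg i)
  have hψ : ψ ∈ (formSum Z W).dom := by
    rw [formSum_dom hR]
    exact mem_W12per_iff.2 ⟨hW, hper⟩
  refine ⟨hψ, ?_⟩
  have hgi' : ∀ i, weakPartial R i (toW12 Z W ⟨ψ, hψ⟩) = g i := hgi
  have l0 : Tendsto (fun n => ‖((u n - ⟨ψ, hψ⟩ : (formSum Z W).dom) : L2 R)‖) atTop (𝓝 0) :=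
    tendsto_iff_norm_sub_tendsto_zero.1 hu
  have l1 : ∀ i, Tendsto (fun n => ‖weakPartial R i (toW12 Z W (u n - ⟨ψ, hψ⟩))‖) atTop (𝓝 0) := by
    intro i
    simp only [map_sub, hgi']
    exact tendsto_iff_norm_sub_tendsto_zero.1 (hg i)
  have l2 := ((tendsto_finsetSum Finset.univ fun i _ => (l1 i).pow 2).const_mul 2).add
    ((l0.pow 2).const_mul C)
  simp only [ne_eq, OfNat.ofNat_ne_zero, not_false_eq_true, zero_pow, mul_zero, add_zero,
    Finset.sum_const_zero] at l2
  exact squeeze_zero_norm (fun n => (h _).2) l2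

end Slab

/-! ### The main theorem -/

theorem mainTheorem3 (R : ℝ) (hR : 0 < R) (W : Lp ℝ ∞ (Slab.μ R)) :
    (∀ ε : ℝ, 0 < ε → ∃ C : ℝ, 0 < C ∧ ∀ ψ : Slab.W12 R,
      Integrable (fun x => |Slab.V W x| * ‖(ψ : Slab.L2 R) x‖ ^ 2) (Slab.μ R) ∧
      ∫ x in Slab.Ω R, |Slab.V W x| * ‖(ψ : Slab.L2 R) x‖ ^ 2 ≤
        (1 + ε) * (∫ x in Slab.Ω R, Slab.gradSq ψ x) + C * ‖(ψ : Slab.L2 R)‖ ^ 2) ∧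
    (∀ Z : ℝ, 0 ≤ Z → Z < 1 →
      (Slab.formSum Z W).dom = (Slab.kineticForm R).dom ∧
      Dense ((Slab.formSum Z W).dom : Set (Slab.L2 R)) ∧
      (Slab.formSum Z W).IsSymm ∧
      (Slab.formSum Z W).IsBoundedBelow ∧
      (Slab.formSum Z W).IsClosed ∧
      IsSelfAdjoint (Slab.formSum Z W).operator ∧
      (Slab.formSum Z W).operator.IsSemibounded) := by
  refine ⟨fun ε hε => Slab.potential_bound hR W hε, fun Z hZ hZ1 => ?_⟩
  have hdom := Slab.formSum_dom hR Z W
  have hd : Dense ((Slab.formSum Z W).dom : Set (Slab.L2 R)) := by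
    rw [hdom]
    exact Slab.dense_W12per R
  have hs := Slab.formSum_isSymm Z W
  have hb := Slab.formSum_isBoundedBelow hR hZ hZ1 W
  have hc := Slab.formSum_isClosed hR hZ hZ1 W
  exact ⟨hdom, hd, hs, hb, hc, SesqForm.operator_isSelfAdjoint _ hd hs hb hc,
    SesqForm.operator_isSemibounded _ hd hb⟩
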